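/- Let $d\ge 2$, $\alpha,\beta\ge 0$ with $\alpha+\beta\ge\frac{d+2}{2}$, and let $g:[0,\infty)\to[0,\infty)$ be a non-decreasing function, positive on $[1,\infty)$, such that $x^{-\alpha}g(x)$ is eventually non-increasing and $\int_1^\infty\frac{ds}{s\,g(s)}=\infty$. Let $D_1,D_2$ be Fourier multipliers with real even symbols $m_1,m_2$ on $\mathbb{Z}^d$ such that, for some $c>0$ and all $k\in\mathbb{Z}^d\setminus\{0\}$, $$m_1(k)\ge c\,\frac{|k|^\alpha}{g(|k|)},\qquad m_2(k)\ge c\,|k|^\beta .$$ Consider on $[0,2\pi]^d$, with periodic boundary conditions, the generalized Leray $\alpha$-model $$\partial_t v+(u\cdot\nabla)v+\nabla p+D_1v=0,\qquad v=D_2u,\qquad \nabla\cdot v=0,\qquad \int v\,dx=\int u\,dx=0,$$ that is, for the Fourier coefficients $v_k(t)\in\mathbb{C}^d$, $k\in\mathbb{Z}^d$, with $v_0=0$, $\langle v_k,k\rangle=0$, $v_{-k}=\overline{v_k}$, $$v_k'=-m_1(k)v_k-i\sum_{h\in\mathbb{Z}^d\setminus\{0\}}\frac{\langle v_h,k\rangle}{m_2(h)}P_k(v_{k-h}),\qquad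 P_k(w)=w-\frac{\langle w,k\rangle}{|k|^2}k,\qquad k\ne 0 .$$ For real $m$ let $V_m$ be the space of real, divergence-free, mean-zero periodic fields with $\|v\|_m^2=\sum_k(1+|k|^2)^m|v_k|^2<\infty$. A solution in $H^m$ on a time interval is a $V_m$-valued map $v$ each of whose Fourier coefficients is differentiable and satisfies the equation above on that interval, and which is continuous for the weak topology of $V_m$ and right-continuous for the strong topology of $V_m$. The maximal time of existence $T_\star\in[0,\infty]$ for an initial value $v(0)\in V_m$ is the supremum of all $T>0$ such that a solution in $H^m$ on $[0,T]$ with this initial value exists. Let $\Phi:[0,\infty)\to[0,1]$ be any smooth function with $\Phi\equiv1$ on $[0,1]$, $\Phi\equiv0$ on $[2,\infty)$ and $\Phi$ strictly decreasing on $[1,2]$; put $\psi(x)=\Phi(x)-\Phi(2x)$ and $\psi_n(k)=\psi(2^{-n}|k|)$. The shell approximation of $v$ is $$X_n(t)=\Bigl(\sum_{k\in\mathbb{Z}^d}\psi_n(k)\,|v_k(t)|^2\Bigr)^{1/2},\qquad n=0,1,2,\dots$$ Theorem. Let $m\ge 2+\frac d2$ be real, let $v(0)$ be a smooth periodic vector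 field that is divergence-free and has mean zero, and let $v$ be a solution in $H^m$ with initial value $v(0)$ on its maximal interval of existence $[0,T_\star)$. If $$\sup_{t\in[0,T_\star)}\ \sum_{n\ge0}2^{2mn}X_n(t)^2<\infty ,$$ then $T_\star=\infty$. -/

import Mathlib

open Filter Topology Set MeasureTheory
open scoped ENNReal ContDiff

noncomputable section

namespace LerayAlpha

/-- A periodic vector field on the `d`-dimensional torus, given by its Fourier coefficients
`v_k`, for `k` in `ℤ^d`. -/
abbrev Field (d : ℕ) : Type := (Fin d → ℤ) → EuclideanSpace ℂ (Fin d)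

/-- The Euclidean length `|k|` of a frequency `k`. -/
def freqNorm {d : ℕ} (k : Fin d → ℤ) : ℝ := Real.sqrt (∑ i, (k i : ℝ) ^ 2)

/-- The bilinear pairing `⟨w, k⟩ = ∑ w_i k_i` of a complex vector and a frequency. -/
def dotFreq {d : ℕ} (w : EuclideanSpace ℂ (Fin d)) (k : Fin d → ℤ) : ℂ :=
  ∑ i, w i * (k i : ℂ)

/-- A frequency as a complex vector. -/
def freqVec {d : ℕ} (k : Fin d → ℤ) : EuclideanSpace ℂ (Fin d) :=
  WithLp.toLp 2 fun i => (k i : ℂ)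

/-- Componentwise complex conjugation. -/
def conjVec {d : ℕ} (w : EuclideanSpace ℂ (Fin d)) : EuclideanSpace ℂ (Fin d) :=
  WithLp.toLp 2 fun i => (starRingEnd ℂ) (w i)

/-- The projection `P_k w = w - (⟨w, k⟩ / |k|²) k`. It is used for `k ≠ 0` only. -/
def leray {d : ℕ} (k : Fin d → ℤ) (w : EuclideanSpace ℂ (Fin d)) : EuclideanSpace ℂ (Fin d) :=
  w - (dotFreq w k / ((freqNorm k ^ 2 : ℝ) : ℂ)) • freqVec k

/-- The Sobolev weight `(1 + |k|²)^γ`. -/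
def sobWeight {d : ℕ} (γ : ℝ) (k : Fin d → ℤ) : ℝ := (1 + freqNorm k ^ 2) ^ γ

/-- Membership in the periodic Sobolev space `H^γ`. -/
def MemH {d : ℕ} (γ : ℝ) (v : Field d) : Prop :=
  Summable fun k => sobWeight γ k * ‖v k‖ ^ 2

/-- The squared norm of `H^γ`. -/
def sobNormSq {d : ℕ} (γ : ℝ) (v : Field d) : ℝ := ∑' k, sobWeight γ k * ‖v k‖ ^ 2

/-- The scalar product of `H^γ`. -/
def sobInner {d : ℕ} (γ : ℝ) (v w : Field d) : ℂ :=
  ∑' k, (sobWeight γ k : ℂ) * inner ℂ (w k) (v k)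

/-- Membership in `V_γ`: the real vector fields in `H^γ` that are divergence free and have
mean zero. -/
structure MemV {d : ℕ} (γ : ℝ) (v : Field d) : Prop where
  memH : MemH γ v
  real : ∀ k, v (-k) = conjVec (v k)
  divFree : ∀ k, dotFreq (v k) k = 0
  meanZero : v 0 = 0

/-- The `k`-th Fourier coefficient of the right-hand side of
`∂ₜ v = - D₁ v - Π ((D₂⁻¹ v · ∇) v)`, where `Π` is the projection on divergence free fields and
`D₁`, `D₂` are the Fourier multipliers with symbols `m₁`, `m₂`. The term with `h = 0` vanishes
for fields of mean zero, and the series converges absolutely for fields that are square summable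
if `m₂` is bounded away from zero off the origin. -/
def vectorField {d : ℕ} (m₁ m₂ : (Fin d → ℤ) → ℝ) (v : Field d) (k : Fin d → ℤ) :
    EuclideanSpace ℂ (Fin d) :=
  -((m₁ k : ℂ) • v k)
    - Complex.I • ∑' h : Fin d → ℤ, (dotFreq (v h) k / (m₂ h : ℂ)) • leray k (v (k - h))

/-- `v` is a solution in `H^m` on the time interval `S` (an interval containing its left end
point `0`): it takes values in `V_m`, each Fourier coefficient solves its equation (with a one-sided
derivative at the end points that belong to `S`), and `v` is continuous for the weak topology of
`V_m` and right-continuous for the strong one. -/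
structure IsSolutionOn {d : ℕ} (m : ℝ) (m₁ m₂ : (Fin d → ℤ) → ℝ) (S : Set ℝ)
    (v : ℝ → Field d) : Prop where
  memV : ∀ t ∈ S, MemV m (v t)
  equation : ∀ t ∈ S, ∀ k : Fin d → ℤ, k ≠ 0 →
    HasDerivWithinAt (fun s => v s k) (vectorField m₁ m₂ (v t) k) S t
  weakCont : ∀ w : Field d, MemV m w → ContinuousOn (fun t => sobInner m (v t) w) S
  rightCont : ∀ t ∈ S,
    Tendsto (fun s => sobNormSq m (fun k => v s k - v t k)) (𝓝[S ∩ Ioi t] t) (𝓝 0)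

/-- The maximal time of existence of the solution in `H^m` started at `v₀`: the supremum of all
`T > 0` such that there is a solution on `[0, T]` with initial value `v₀`. -/
def maximalTime {d : ℕ} (m : ℝ) (m₁ m₂ : (Fin d → ℤ) → ℝ) (v₀ : Field d) : ℝ≥0∞ :=
  sSup {T : ℝ≥0∞ | ∃ r : ℝ, 0 < r ∧ T = ENNReal.ofReal r ∧
    ∃ w : ℝ → Field d, w 0 = v₀ ∧ IsSolutionOn m m₁ m₂ (Icc 0 r) w}

/-- The time interval `[0, T)`, for `T` in `[0, ∞]`. -/
def timeInterval (T : ℝ≥0∞) : Set ℝ := {t | 0 ≤ t ∧ ENNReal.ofReal t < T}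

/-- `v` is a solution in `H^m` on its maximal interval of existence `[0, T)`. -/
structure IsMaximalSolution {d : ℕ} (m : ℝ) (m₁ m₂ : (Fin d → ℤ) → ℝ) (T : ℝ≥0∞)
    (v : ℝ → Field d) : Prop where
  initial : MemV m (v 0)
  maximal : T = maximalTime m m₁ m₂ (v 0)
  solution : IsSolutionOn m m₁ m₂ (timeInterval T) v

/-- The `k`-th Fourier coefficient `(2π)^{-d} ∫_{[0,2π]^d} f(x) e^{-i⟨k,x⟩} dx`. -/
def fourierCoeffs {d : ℕ} (f : EuclideanSpace ℝ (Fin d) → EuclideanSpace ℝ (Fin d)) : Field d :=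
  fun k => WithLp.toLp 2 fun i =>
    ((2 * Real.pi : ℂ) ^ d)⁻¹ *
      ∫ x in {x : EuclideanSpace ℝ (Fin d) | ∀ j, x j ∈ Icc 0 (2 * Real.pi)},
        Complex.exp (-(Complex.I * ∑ j, (k j : ℂ) * (x j : ℂ))) * (f x i : ℂ)

/-- `v` is (the family of Fourier coefficients of) a smooth vector field on `ℝ^d` that is
`2π`-periodic in each variable. -/
def IsSmoothPeriodic {d : ℕ} (v : Field d) : Prop :=
  ∃ f : EuclideanSpace ℝ (Fin d) → EuclideanSpace ℝ (Fin d),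
    ContDiff ℝ ∞ f ∧ (∀ x i, f (x + EuclideanSpace.single i (2 * Real.pi)) = f x) ∧
      v = fourierCoeffs f

/-- The cut-off functions `Φ : [0, ∞) → [0, 1]` admitted in the dyadic decomposition. -/
structure IsCutoff (Φ : ℝ → ℝ) : Prop where
  smooth : ContDiffOn ℝ ∞ Φ (Ici 0)
  mapsTo : ∀ x, 0 ≤ x → Φ x ∈ Icc (0 : ℝ) 1
  eq_one : ∀ x, 0 ≤ x → x ≤ 1 → Φ x = 1
  eq_zero : ∀ x, 2 ≤ x → Φ x = 0
  strictAnti : StrictAntiOn Φ (Icc 1 2)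

/-- The radial bump function `ψ_n(k) = ψ(2^{-n} |k|)` with `ψ(x) = Φ(x) - Φ(2x)`. -/
def shellBump {d : ℕ} (Φ : ℝ → ℝ) (n : ℕ) (k : Fin d → ℤ) : ℝ :=
  Φ (freqNorm k / 2 ^ n) - Φ (2 * (freqNorm k / 2 ^ n))

/-- The shell approximation `X_n(t) = (∑_k ψ_n(k) |v_k(t)|²)^{1/2}` of `v`
(only finitely many terms of the sum are not zero). -/
def shellApprox {d : ℕ} (Φ : ℝ → ℝ) (v : ℝ → Field d) (n : ℕ) (t : ℝ) : ℝ :=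
  Real.sqrt (∑' k : Fin d → ℤ, shellBump Φ n k * ‖v t k‖ ^ 2)

end LerayAlpha

end

namespace LerayAlpha

variable {d : ℕ}

/-! ### Frequencies and vectors -/

/-! The hypothesis on the shells is a bound in `H^m`: the bumps `ψ_n`, `n ≥ 0`, sum to one off the
origin, and `1 + |k|²` is at most a constant times `4^n` on the support of `ψ_n`
(`IsCutoff.sobNormSq_le`). So it suffices that a solution bounded in `H^m` can be continued. This
follows from local existence on a time interval whose length depends only on the norm of the initial
value (`exists_isSolutionOn`): a restart shortly before a finite `T_⋆` yields a solution living past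
`T_⋆`. As `T_⋆` is a supremum over all solutions with the given initial value, gluing is enough and
uniqueness plays no role.

Local existence rests on one energy estimate for trigonometric polynomials,
`IsTrigPoly.energy_rate_le`: for every radially non-decreasing weight `W` of polynomial growth, `∑
W(k)|v_k|²` grows at a rate of at most a constant times `∑ |k||v_k|` times itself. The dissipation
has a sign and is dropped. The transport term is skew, so `W(k)` may be replaced by `(W(k) -
W(l))/2`, and this difference gains the derivative that the nonlinearity loses
(`IsWeight.sub_mul_le`). As `m > 1 + d/2`, the factor `∑ |k||v_k|` is controlled by the `H^m` norm.

The estimate is used for two weights. The Sobolev weight gives `E' ≤ A E^{3/2}`, hence a bound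
uniform over all Galerkin approximations on a common time interval. The Sobolev weight times `min(1,
|k|/R)` then gives a linear Grönwall inequality with a constant independent of `R`, so the tails of
the initial value control the tails at later times, uniformly in the truncation. A limit of the
approximations along an ultrafilter therefore solves the equation and is strongly continuous in
`H^m`. -/

theorem freqNorm_nonneg (k : Fin d → ℤ) : 0 ≤ freqNorm k := Real.sqrt_nonneg _

theorem freqNorm_sq (k : Fin d → ℤ) : freqNorm k ^ 2 = ∑ i, (k i : ℝ) ^ 2 :=
  Real.sq_sqrt (Finset.sum_nonneg fun _ _ => sq_nonneg _)

theorem freqNorm_neg (k : Fin d → ℤ) : freqNorm (-k) = freqNorm k := by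
  simp [freqNorm]

theorem freqNorm_zero : freqNorm (0 : Fin d → ℤ) = 0 := by
  simp [freqNorm]

theorem freqNorm_eq_norm (k : Fin d → ℤ) :
    freqNorm k = ‖(WithLp.toLp 2 fun i => (k i : ℝ) : EuclideanSpace ℝ (Fin d))‖ := by
  simp [freqNorm, EuclideanSpace.norm_eq]

theorem freqNorm_add_le (k l : Fin d → ℤ) : freqNorm (k + l) ≤ freqNorm k + freqNorm l := by
  simp only [freqNorm_eq_norm]
  refine le_trans (le_of_eq ?_) (norm_add_le _ _)
  congr 1
  ext i
  simp

theorem freqNorm_sub_le (k l : Fin d → ℤ) : freqNorm k - freqNorm l ≤ freqNorm (k - l) := by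
  have := freqNorm_add_le (k - l) l
  rw [sub_add_cancel] at this
  linarith

theorem one_le_freqNorm {k : Fin d → ℤ} (hk : k ≠ 0) : 1 ≤ freqNorm k := by
  obtain ⟨i, hi⟩ := Function.ne_iff.1 hk
  rw [freqNorm, Real.one_le_sqrt]
  have h1 : (1 : ℝ) ≤ (k i : ℝ) ^ 2 := by
    have : (1 : ℤ) ≤ (k i) ^ 2 := by
      have := sq_pos_of_ne_zero (a := k i) hi
      omega
    exact_mod_cast this
  exact h1.trans (Finset.single_le_sum (f := fun i => (k i : ℝ) ^ 2)
    (fun _ _ => sq_nonneg _) (Finset.mem_univ i))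

theorem dotFreq_eq_inner (w : EuclideanSpace ℂ (Fin d)) (k : Fin d → ℤ) :
    dotFreq w k = inner ℂ (freqVec k) w := by
  simp [dotFreq, freqVec, PiLp.inner_apply]

theorem norm_freqVec (k : Fin d → ℤ) : ‖freqVec k‖ = freqNorm k := by
  simp [freqVec, freqNorm, EuclideanSpace.norm_eq]

theorem norm_dotFreq_le (w : EuclideanSpace ℂ (Fin d)) (k : Fin d → ℤ) :
    ‖dotFreq w k‖ ≤ freqNorm k * ‖w‖ := by
  rw [dotFreq_eq_inner, ← norm_freqVec]
  exact norm_inner_le_norm _ _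

theorem dotFreq_sub_right (w : EuclideanSpace ℂ (Fin d)) (k l : Fin d → ℤ) :
    dotFreq w (k - l) = dotFreq w k - dotFreq w l := by
  simp [dotFreq, mul_sub, Finset.sum_sub_distrib]

theorem dotFreq_neg_right (w : EuclideanSpace ℂ (Fin d)) (k : Fin d → ℤ) :
    dotFreq w (-k) = -dotFreq w k := by
  simp [dotFreq]

theorem dotFreq_freqVec (k : Fin d → ℤ) : dotFreq (freqVec k) k = ((freqNorm k ^ 2 : ℝ) : ℂ) := by
  rw [freqNorm_sq]
  simp [dotFreq, freqVec, sq]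

theorem freqVec_neg (k : Fin d → ℤ) : freqVec (-k) = -freqVec k := by
  ext i; simp [freqVec]

/-- The pairing with a frequency as a linear map. -/
noncomputable def dotFreqL (k : Fin d → ℤ) : EuclideanSpace ℂ (Fin d) →L[ℂ] ℂ := innerSL ℂ (freqVec k)

theorem dotFreqL_apply (k : Fin d → ℤ) (w : EuclideanSpace ℂ (Fin d)) :
    dotFreqL k w = dotFreq w k := by
  simp [dotFreqL, dotFreq_eq_inner]

/-- The projection `P_k` as a linear map. -/
noncomputable def lerayL (k : Fin d → ℤ) : EuclideanSpace ℂ (Fin d) →L[ℂ] EuclideanSpace ℂ (Fin d) :=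
  ContinuousLinearMap.id ℂ _ -
    ((((freqNorm k ^ 2 : ℝ) : ℂ)⁻¹) • dotFreqL k).smulRight (freqVec k)

theorem lerayL_apply (k : Fin d → ℤ) (w : EuclideanSpace ℂ (Fin d)) :
    lerayL k w = leray k w := by
  simp [lerayL, leray, dotFreqL_apply, div_eq_inv_mul]

theorem dotFreq_leray {k : Fin d → ℤ} (hk : k ≠ 0) (w : EuclideanSpace ℂ (Fin d)) :
    dotFreq (leray k w) k = 0 := by
  have h : ((freqNorm k ^ 2 : ℝ) : ℂ) ≠ 0 := by
    have := one_le_freqNorm hk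
    exact_mod_cast (by positivity : freqNorm k ^ 2 ≠ 0)
  rw [leray, ← dotFreqL_apply, map_sub, map_smul, dotFreqL_apply, dotFreqL_apply, dotFreq_freqVec,
    smul_eq_mul, div_mul_cancel₀ _ h, sub_self]

theorem norm_leray_le (k : Fin d → ℤ) (w : EuclideanSpace ℂ (Fin d)) :
    ‖leray k w‖ ≤ 2 * ‖w‖ := by
  rcases eq_or_ne k 0 with rfl | hk
  · simp [leray, freqNorm_zero]
    linarith [norm_nonneg w]
  have h1 := one_le_freqNorm hk
  have h2 : ‖(dotFreq w k / ((freqNorm k ^ 2 : ℝ) : ℂ)) • freqVec k‖ ≤ ‖w‖ := by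
    rw [norm_smul, norm_div, norm_freqVec, Complex.norm_real, Real.norm_of_nonneg (by positivity),
      div_mul_eq_mul_div, div_le_iff₀ (by positivity)]
    nlinarith [norm_dotFreq_le w k]
  rw [leray]
  linarith [norm_sub_le w ((dotFreq w k / ((freqNorm k ^ 2 : ℝ) : ℂ)) • freqVec k)]

/-- The correction made by `P_k` is parallel to `k`, hence orthogonal to `v`. This removes the
pressure from the energy balance. -/
theorem inner_leray {k : Fin d → ℤ} {v : EuclideanSpace ℂ (Fin d)} (hv : dotFreq v k = 0)
    (w : EuclideanSpace ℂ (Fin d)) : inner ℂ v (leray k w) = inner ℂ v w := by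
  rw [dotFreq_eq_inner] at hv
  rw [leray, inner_sub_right, inner_smul_right, inner_eq_zero_symm.1 hv, mul_zero, sub_zero]

theorem norm_conjVec (w : EuclideanSpace ℂ (Fin d)) : ‖conjVec w‖ = ‖w‖ := by
  simp [conjVec, EuclideanSpace.norm_eq]

theorem conjVec_add (v w : EuclideanSpace ℂ (Fin d)) : conjVec (v + w) = conjVec v + conjVec w := by
  ext i; simp [conjVec]

theorem conjVec_sub (v w : EuclideanSpace ℂ (Fin d)) : conjVec (v - w) = conjVec v - conjVec w := by
  ext i; simp [conjVec]

theorem conjVec_neg (v : EuclideanSpace ℂ (Fin d)) : conjVec (-v) = -conjVec v := by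
  ext i; simp [conjVec]

theorem conjVec_zero : conjVec (0 : EuclideanSpace ℂ (Fin d)) = 0 := by
  ext i; simp [conjVec]

theorem conjVec_smul (z : ℂ) (v : EuclideanSpace ℂ (Fin d)) :
    conjVec (z • v) = (starRingEnd ℂ z) • conjVec v := by
  ext i; simp [conjVec]

theorem conjVec_sum {ι : Type*} (s : Finset ι) (v : ι → EuclideanSpace ℂ (Fin d)) :
    conjVec (∑ j ∈ s, v j) = ∑ j ∈ s, conjVec (v j) := by
  ext i; simp [conjVec]

theorem conjVec_freqVec (k : Fin d → ℤ) : conjVec (freqVec k) = freqVec k := by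
  ext i; simp [conjVec, freqVec]

theorem dotFreq_conjVec (w : EuclideanSpace ℂ (Fin d)) (k : Fin d → ℤ) :
    dotFreq (conjVec w) k = starRingEnd ℂ (dotFreq w k) := by
  simp [dotFreq, conjVec]

theorem leray_conjVec (k : Fin d → ℤ) (w : EuclideanSpace ℂ (Fin d)) :
    leray k (conjVec w) = conjVec (leray k w) := by
  rw [leray, leray, conjVec_sub, conjVec_smul, conjVec_freqVec, dotFreq_conjVec, map_div₀,
    Complex.conj_ofReal]

theorem leray_neg (k : Fin d → ℤ) (w : EuclideanSpace ℂ (Fin d)) :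
    leray (-k) w = leray k w := by
  rw [leray, leray, dotFreq_neg_right, freqVec_neg, freqNorm_neg, neg_div, neg_smul_neg]

theorem continuous_conjVec : Continuous (conjVec (d := d)) := by
  have : LipschitzWith 1 (conjVec (d := d)) := by
    refine LipschitzWith.of_dist_le_mul fun x y => ?_
    rw [dist_eq_norm, dist_eq_norm, ← conjVec_sub, norm_conjVec]
    simp
  exact this.continuous

/-! ### Weights -/

/-- Radially non-decreasing weights on `ℤ^d` of growth at most `|k| ^ n`. -/
structure IsWeight (n : ℕ) (W : (Fin d → ℤ) → ℝ) : Prop where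
  nonneg : ∀ k, 0 ≤ W k
  mono : ∀ k l, freqNorm k ≤ freqNorm l → W k ≤ W l
  growth : ∀ k l, k ≠ 0 → freqNorm k ≤ freqNorm l → W l * freqNorm k ^ n ≤ W k * freqNorm l ^ n

theorem one_le_one_add_sq (k : Fin d → ℤ) : 1 ≤ 1 + freqNorm k ^ 2 := by
  linarith [sq_nonneg (freqNorm k)]

theorem sobWeight_pos (γ : ℝ) (k : Fin d → ℤ) : 0 < sobWeight γ k :=
  Real.rpow_pos_of_pos (by linarith [one_le_one_add_sq k]) _

theorem one_le_sobWeight {γ : ℝ} (hγ : 0 ≤ γ) (k : Fin d → ℤ) : 1 ≤ sobWeight γ k :=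
  Real.one_le_rpow (one_le_one_add_sq k) hγ

theorem isWeight_sobWeight {γ : ℝ} (hγ : 0 ≤ γ) {n : ℕ} (hn : 2 * γ ≤ n) :
    IsWeight n (sobWeight (d := d) γ) where
  nonneg k := (sobWeight_pos γ k).le
  mono k l h := by
    have := freqNorm_nonneg k
    unfold sobWeight
    gcongr
  growth k l hk h := by
    have hr := one_le_freqNorm hk
    have hr0 : 0 < freqNorm k := by linarith
    have hq : 1 ≤ freqNorm l / freqNorm k := (one_le_div hr0).2 h
    have h1 : 1 + freqNorm l ^ 2 ≤ (1 + freqNorm k ^ 2) * (freqNorm l / freqNorm k) ^ 2 := by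
      have h2 : freqNorm l ^ 2 = freqNorm k ^ 2 * (freqNorm l / freqNorm k) ^ 2 := by
        field_simp
      nlinarith
    have h2 : sobWeight γ l ≤ sobWeight γ k * (freqNorm l / freqNorm k) ^ n := by
      calc sobWeight γ l ≤ ((1 + freqNorm k ^ 2) * (freqNorm l / freqNorm k) ^ 2) ^ γ := by
            unfold sobWeight
            gcongr
        _ = sobWeight γ k * (freqNorm l / freqNorm k) ^ (2 * γ) := by
            rw [Real.mul_rpow (by positivity) (by positivity), sobWeight,
              ← Real.rpow_natCast (freqNorm l / freqNorm k) 2, ← Real.rpow_mul (by positivity)]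
            norm_num
        _ ≤ sobWeight γ k * (freqNorm l / freqNorm k) ^ (n : ℝ) := by
            have := (sobWeight_pos γ k).le
            gcongr
        _ = _ := by rw [Real.rpow_natCast]
    rw [div_pow, mul_div_assoc', le_div_iff₀ (by positivity)] at h2
    exact h2

/-- The factor `min 1 (|k| / R)` is non-decreasing and grows at most linearly, so it costs one
power. The exponent `n + 1` does not involve `R`, which makes tail estimates uniform in `R`. -/
theorem IsWeight.mul_min {n : ℕ} {W : (Fin d → ℤ) → ℝ} (hW : IsWeight n W) {R : ℝ} (hR : 0 < R) :
    IsWeight (n + 1) fun k => W k * min 1 (freqNorm k / R) where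
  nonneg k := mul_nonneg (hW.nonneg k) (le_min zero_le_one (div_nonneg (freqNorm_nonneg k) hR.le))
  mono k l h := by
    have h0 : 0 ≤ min 1 (freqNorm k / R) :=
      le_min zero_le_one (div_nonneg (freqNorm_nonneg k) hR.le)
    exact mul_le_mul (hW.mono k l h) (min_le_min le_rfl (by gcongr)) h0 (hW.nonneg l)
  growth k l hk h := by
    have hk0 := freqNorm_nonneg k
    have h1 : min 1 (freqNorm l / R) * freqNorm k ≤ min 1 (freqNorm k / R) * freqNorm l := by
      rcases le_total 1 (freqNorm k / R) with h2 | h2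
      · rw [min_eq_left h2, one_mul]
        exact (mul_le_of_le_one_left hk0 (min_le_left _ _)).trans h
      · rw [min_eq_right h2]
        calc _ ≤ freqNorm l / R * freqNorm k := by gcongr; exact min_le_right _ _
          _ = _ := by ring
    have h2 := hW.growth k l hk h
    calc W l * min 1 (freqNorm l / R) * freqNorm k ^ (n + 1)
        = (W l * freqNorm k ^ n) * (min 1 (freqNorm l / R) * freqNorm k) := by ring
      _ ≤ (W k * freqNorm l ^ n) * (min 1 (freqNorm k / R) * freqNorm l) := by
          refine mul_le_mul h2 h1 ?_ ?_
          · exact mul_nonneg (le_min zero_le_one (div_nonneg (freqNorm_nonneg l) hR.le)) hk0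
          · exact mul_nonneg (hW.nonneg k) (pow_nonneg (freqNorm_nonneg l) _)
      _ = _ := by ring

/-- Convexity: on `[0, 1]` the power lies below its chord. -/
theorem one_add_pow_le (n : ℕ) {x : ℝ} (h0 : 0 ≤ x) (h1 : x ≤ 1) :
    (1 + x) ^ n ≤ 1 + (2 ^ n - 1) * x := by
  induction n with
  | zero => simp
  | succ n ih =>
    have h2 : (1 : ℝ) ≤ 2 ^ n := one_le_pow₀ (by norm_num)
    rw [pow_succ, pow_succ]
    nlinarith [mul_le_mul_of_nonneg_right ih (by linarith : 0 ≤ 1 + x),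
      mul_nonneg (mul_nonneg h0 (sub_nonneg.2 h1)) (sub_nonneg.2 h2)]

/-- The right-hand side of the commutator estimate for weights. -/
noncomputable def commBound (W : (Fin d → ℤ) → ℝ) (k l : Fin d → ℤ) : ℝ :=
  freqNorm (k - l) * √(W k) * √(W l) + freqNorm l * √(W (k - l)) * √(W k)
    + freqNorm k * √(W (k - l)) * √(W l)

/-- If `|k| ≤ 2|l|`, the growth condition and the chord bound make `W k - W l` at most `2^n W l`
times `(|k| - |l|) / |l|`, so the factor `|l|` is traded for `|k - l|`. If `|k| > 2|l|`, then `|k| ≤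
2|k - l|`, and half of the weight is moved from `k` to `k - l`. -/
theorem IsWeight.sub_mul_le {n : ℕ} {W : (Fin d → ℤ) → ℝ} (hW : IsWeight n W) {k l : Fin d → ℤ}
    (hl : l ≠ 0) (h : freqNorm l ≤ freqNorm k) :
    (W k - W l) * freqNorm l ≤ 2 ^ n * (freqNorm (k - l) * √(W k) * √(W l) +
      freqNorm l * √(W (k - l)) * √(W k)) := by
  have hr := one_le_freqNorm hl
  have hr0 : 0 < freqNorm l := by linarith
  have hh := freqNorm_sub_le k l
  have hh0 := freqNorm_nonneg (k - l)
  have hWl := hW.nonneg l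
  have h2n : (1 : ℝ) ≤ 2 ^ n := one_le_pow₀ (by norm_num)
  have hsl := Real.mul_self_sqrt hWl
  have hsk := Real.mul_self_sqrt (hW.nonneg k)
  have hs : √(W l) ≤ √(W k) := Real.sqrt_le_sqrt (hW.mono _ _ h)
  rcases le_or_gt (freqNorm k) (2 * freqNorm l) with h2 | h2
  · have hx0 : 0 ≤ (freqNorm k - freqNorm l) / freqNorm l := div_nonneg (by linarith) hr0.le
    have hx1 : (freqNorm k - freqNorm l) / freqNorm l ≤ 1 := (div_le_one hr0).2 (by linarith)
    have h3 := one_add_pow_le n hx0 hx1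
    have h4 : 1 + (freqNorm k - freqNorm l) / freqNorm l = freqNorm k / freqNorm l := by
      field_simp; ring
    rw [h4] at h3
    have h5 : W k ≤ W l * (freqNorm k / freqNorm l) ^ n := by
      rw [div_pow, mul_div_assoc', le_div_iff₀ (by positivity)]
      exact hW.growth l k hl h
    have h6 : W k - W l ≤ W l * ((2 ^ n - 1) * ((freqNorm k - freqNorm l) / freqNorm l)) := by
      nlinarith
    have h7 : (W k - W l) * freqNorm l ≤ W l * (2 ^ n - 1) * (freqNorm k - freqNorm l) := by
      calc _ ≤ W l * ((2 ^ n - 1) * ((freqNorm k - freqNorm l) / freqNorm l)) * freqNorm l := by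
            gcongr
        _ = _ := by field_simp
    calc _ ≤ W l * (2 ^ n - 1) * (freqNorm k - freqNorm l) := h7
      _ ≤ W l * 2 ^ n * freqNorm (k - l) := by
          gcongr
          linarith
      _ = 2 ^ n * (freqNorm (k - l) * √(W l) * √(W l)) := by rw [mul_assoc _ √(W l), hsl]; ring
      _ ≤ 2 ^ n * (freqNorm (k - l) * √(W k) * √(W l)) := by gcongr
      _ ≤ _ := by gcongr; exact le_add_of_nonneg_right (by positivity)
  -- The growth condition is available only at nonzero frequencies.
  · have hkl : k - l ≠ 0 := by
      intro h0
      rw [sub_eq_zero.1 h0] at h2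
      linarith
    have h3 := one_le_freqNorm hkl
    have h4 : W k ≤ 2 ^ n * W (k - l) := by
      rcases le_total (freqNorm k) (freqNorm (k - l)) with h5 | h5
      · nlinarith [hW.mono _ _ h5, hW.nonneg (k - l)]
      · have h6 := hW.growth _ _ hkl h5
        have h7 : freqNorm k ^ n ≤ 2 ^ n * freqNorm (k - l) ^ n := by
          rw [← mul_pow]
          exact pow_le_pow_left₀ (freqNorm_nonneg k) (by linarith) _
        have h8 : W k * freqNorm (k - l) ^ n ≤ (2 ^ n * W (k - l)) * freqNorm (k - l) ^ n := by
          nlinarith [hW.nonneg (k - l)]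
        exact le_of_mul_le_mul_right h8 (by positivity)
    have h5 : √(W k) ≤ 2 ^ n * √(W (k - l)) := by
      rw [Real.sqrt_le_left (by positivity), mul_pow, Real.sq_sqrt (hW.nonneg _)]
      nlinarith [hW.nonneg (k - l), mul_nonneg (sub_nonneg.2 h2n) (hW.nonneg (k - l))]
    calc _ ≤ W k * freqNorm l := by gcongr; linarith
      _ = √(W k) * √(W k) * freqNorm l := by rw [hsk]
      _ ≤ 2 ^ n * √(W (k - l)) * √(W k) * freqNorm l := by gcongr
      _ = 2 ^ n * (freqNorm l * √(W (k - l)) * √(W k)) := by ring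
      _ ≤ _ := by gcongr; exact le_add_of_nonneg_left (by positivity)

theorem IsWeight.even {n : ℕ} {W : (Fin d → ℤ) → ℝ} (hW : IsWeight n W) (k : Fin d → ℤ) :
    W (-k) = W k :=
  le_antisymm (hW.mono _ _ (freqNorm_neg k).le) (hW.mono _ _ (freqNorm_neg k).ge)

/-- The bound of `IsWeight.sub_mul_le` is symmetrized; exchanging `k` and `l` produces the third
term of `commBound`. -/
theorem IsWeight.abs_sub_mul_min_le {n : ℕ} {W : (Fin d → ℤ) → ℝ} (hW : IsWeight n W)
    {k l : Fin d → ℤ} (hk : k ≠ 0) (hl : l ≠ 0) :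
    |W k - W l| * min (freqNorm k) (freqNorm l) ≤ 2 ^ n * commBound W k l := by
  have hk0 := freqNorm_nonneg k
  have hl0 := freqNorm_nonneg l
  rcases le_total (freqNorm l) (freqNorm k) with h | h
  · rw [min_eq_right h, abs_of_nonneg (sub_nonneg.2 (hW.mono _ _ h))]
    refine (hW.sub_mul_le hl h).trans ?_
    refine mul_le_mul_of_nonneg_left ?_ (by positivity)
    exact le_add_of_nonneg_right (by positivity)
  · rw [min_eq_left h, abs_sub_comm, abs_of_nonneg (sub_nonneg.2 (hW.mono _ _ h))]
    refine (hW.sub_mul_le hk h).trans ?_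
    have h1 : freqNorm (l - k) = freqNorm (k - l) := by rw [← freqNorm_neg, neg_sub]
    have h2 : W (l - k) = W (k - l) := by rw [← hW.even, neg_sub]
    have h3 := freqNorm_nonneg (k - l)
    have h4 : 0 ≤ freqNorm l * √(W (k - l)) * √(W k) := by positivity
    unfold commBound
    rw [h1, h2]
    refine mul_le_mul_of_nonneg_left ?_ (by positivity)
    linarith

/-! ### The energy estimate for trigonometric polynomials -/

/-- The full lattice sum is invariant under reflection and translation, although `F` is not. -/
theorem sum_sub_le_sum {F : Finset (Fin d → ℤ)} {f : (Fin d → ℤ) → ℝ} (hf : ∀ k, 0 ≤ f k)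
    (hF : ∀ k, k ∉ F → f k = 0) (k : Fin d → ℤ) : ∑ l ∈ F, f (k - l) ≤ ∑ l ∈ F, f l := by
  have hs : Summable f := summable_of_ne_finset_zero (s := F) fun k hk => hF k hk
  have hs' : Summable fun l => f (k - l) := (Equiv.subLeft k).summable_iff.2 hs
  calc ∑ l ∈ F, f (k - l) ≤ ∑' l, f (k - l) := hs'.sum_le_tsum _ fun _ _ => hf _
    _ = ∑' l, f l := (Equiv.subLeft k).tsum_eq f
    _ = ∑ l ∈ F, f l := tsum_eq_sum fun k hk => hF k hk

theorem sum_sub_le_sum' {F : Finset (Fin d → ℤ)} {f : (Fin d → ℤ) → ℝ} (hf : ∀ k, 0 ≤ f k)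
    (hF : ∀ k, k ∉ F → f k = 0) (l : Fin d → ℤ) : ∑ k ∈ F, f (k - l) ≤ ∑ k ∈ F, f k := by
  have hs : Summable f := summable_of_ne_finset_zero (s := F) fun k hk => hF k hk
  have hs' : Summable fun k => f (k - l) := (Equiv.subRight l).summable_iff.2 hs
  calc ∑ k ∈ F, f (k - l) ≤ ∑' k, f (k - l) := hs'.sum_le_tsum _ fun _ _ => hf _
    _ = ∑' k, f k := (Equiv.subRight l).tsum_eq f
    _ = ∑ k ∈ F, f k := tsum_eq_sum fun k hk => hF k hk

/-- Young's inequality for finite sums, the summable factor being evaluated at `k - l`. -/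
theorem sum_conv_le {F : Finset (Fin d → ℤ)} {a b : (Fin d → ℤ) → ℝ} (ha : ∀ k, 0 ≤ a k)
    (haF : ∀ k, k ∉ F → a k = 0) :
    ∑ k ∈ F, ∑ l ∈ F, a (k - l) * b k * b l ≤ (∑ k ∈ F, a k) * ∑ k ∈ F, b k ^ 2 := by
  have h1 : ∑ k ∈ F, ∑ l ∈ F, a (k - l) * b k ^ 2 ≤ (∑ k ∈ F, a k) * ∑ k ∈ F, b k ^ 2 := by
    rw [Finset.mul_sum]
    refine Finset.sum_le_sum fun k _ => ?_
    rw [← Finset.sum_mul]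
    exact mul_le_mul_of_nonneg_right (sum_sub_le_sum ha haF k) (sq_nonneg _)
  have h2 : ∑ k ∈ F, ∑ l ∈ F, a (k - l) * b l ^ 2 ≤ (∑ k ∈ F, a k) * ∑ k ∈ F, b k ^ 2 := by
    rw [Finset.sum_comm, Finset.mul_sum]
    refine Finset.sum_le_sum fun l _ => ?_
    rw [← Finset.sum_mul]
    exact mul_le_mul_of_nonneg_right (sum_sub_le_sum' ha haF l) (sq_nonneg _)
  have h3 : 2 * ∑ k ∈ F, ∑ l ∈ F, a (k - l) * b k * b l ≤
      ∑ k ∈ F, ∑ l ∈ F, a (k - l) * b k ^ 2 + ∑ k ∈ F, ∑ l ∈ F, a (k - l) * b l ^ 2 := by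
    simp only [Finset.mul_sum, ← Finset.sum_add_distrib]
    refine Finset.sum_le_sum fun k _ => Finset.sum_le_sum fun l _ => ?_
    nlinarith [mul_nonneg (ha (k - l)) (sq_nonneg (b k - b l))]
  linarith

/-- Young's inequality for finite sums, a square summable factor being evaluated at `k - l`. -/
theorem sum_conv_le' {F : Finset (Fin d → ℤ)} {a b : (Fin d → ℤ) → ℝ} (ha : ∀ k, 0 ≤ a k)
    (hbF : ∀ k, k ∉ F → b k = 0) :
    ∑ k ∈ F, ∑ l ∈ F, a l * b (k - l) * b k ≤ (∑ k ∈ F, a k) * ∑ k ∈ F, b k ^ 2 := by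
  rw [Finset.sum_comm, Finset.sum_mul]
  refine Finset.sum_le_sum fun l _ => ?_
  have h1 := sum_sub_le_sum' (F := F) (f := fun k => b k ^ 2) (fun k => sq_nonneg _)
    (fun k hk => by simp [hbF k hk]) l
  calc ∑ k ∈ F, a l * b (k - l) * b k ≤ ∑ k ∈ F, a l * ((b (k - l) ^ 2 + b k ^ 2) / 2) := by
        refine Finset.sum_le_sum fun k _ => ?_
        rw [mul_assoc]
        exact mul_le_mul_of_nonneg_left (by nlinarith [sq_nonneg (b (k - l) - b k)]) (ha l)
    _ = a l * ((∑ k ∈ F, b (k - l) ^ 2 + ∑ k ∈ F, b k ^ 2) / 2) := by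
        rw [← Finset.mul_sum, ← Finset.sum_div, Finset.sum_add_distrib]
    _ ≤ _ := mul_le_mul_of_nonneg_left (by linarith) (ha l)

/-- Young's inequality for finite sums, a square summable factor being evaluated at `k - l`. -/
theorem sum_conv_le'' {F : Finset (Fin d → ℤ)} {a b : (Fin d → ℤ) → ℝ} (ha : ∀ k, 0 ≤ a k)
    (hbF : ∀ k, k ∉ F → b k = 0) :
    ∑ k ∈ F, ∑ l ∈ F, a k * b (k - l) * b l ≤ (∑ k ∈ F, a k) * ∑ k ∈ F, b k ^ 2 := by
  rw [Finset.sum_mul]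
  refine Finset.sum_le_sum fun k _ => ?_
  have h1 := sum_sub_le_sum (F := F) (f := fun k => b k ^ 2) (fun k => sq_nonneg _)
    (fun k hk => by simp [hbF k hk]) k
  calc ∑ l ∈ F, a k * b (k - l) * b l ≤ ∑ l ∈ F, a k * ((b (k - l) ^ 2 + b l ^ 2) / 2) := by
        refine Finset.sum_le_sum fun l _ => ?_
        rw [mul_assoc]
        exact mul_le_mul_of_nonneg_left (by nlinarith [sq_nonneg (b (k - l) - b l)]) (ha k)
    _ = a k * ((∑ l ∈ F, b (k - l) ^ 2 + ∑ l ∈ F, b l ^ 2) / 2) := by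
        rw [← Finset.mul_sum, ← Finset.sum_div, Finset.sum_add_distrib]
    _ ≤ _ := mul_le_mul_of_nonneg_left (by linarith) (ha k)

theorem norm_dotFreq_div_le {m₂ : (Fin d → ℤ) → ℝ} {c : ℝ} (hc : 0 < c)
    (hm₂ : ∀ k, k ≠ 0 → c ≤ m₂ k) {v : Field d} (hv : v 0 = 0) (h k : Fin d → ℤ) :
    ‖dotFreq (v h) k / (m₂ h : ℂ)‖ ≤ c⁻¹ * freqNorm k * ‖v h‖ := by
  -- The value `m₂ 0` is uncontrolled; the vanishing mean covers this case.
  rcases eq_or_ne h 0 with rfl | hh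
  · simp [hv, dotFreq]
  have h1 := hm₂ h hh
  rw [norm_div, Complex.norm_real, Real.norm_of_nonneg (by linarith), mul_assoc, div_eq_inv_mul]
  have := norm_dotFreq_le (v h) k
  gcongr

/-- The fields of mean zero, real and divergence free, whose spectrum lies in `F`. -/
structure IsTrigPoly (F : Finset (Fin d → ℤ)) (v : Field d) : Prop where
  supp : ∀ k, k ∉ F → v k = 0
  real : ∀ k, v (-k) = conjVec (v k)
  divFree : ∀ k, dotFreq (v k) k = 0
  meanZero : v 0 = 0

/-- The integrand of the trilinear form. -/
noncomputable def triTerm (m₂ : (Fin d → ℤ) → ℝ) (v : Field d) (k l : Fin d → ℤ) : ℝ :=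
  (inner ℂ (v k) (Complex.I • ((dotFreq (v (k - l)) k / (m₂ (k - l) : ℂ)) • v l))).re

/-- Since `v (k - l)` is orthogonal to `k - l`, the derivative may be put on either frequency, in
particular on the smaller one. -/
theorem IsTrigPoly.dotFreq_sub {F : Finset (Fin d → ℤ)} {v : Field d} (hv : IsTrigPoly F v)
    (k l : Fin d → ℤ) : dotFreq (v (k - l)) k = dotFreq (v (k - l)) l := by
  have := hv.divFree (k - l)
  rw [dotFreq_sub_right] at this
  exact sub_eq_zero.1 this

/-- Transport by a real divergence-free field is skew-adjoint: exchanging `k` and `l` conjugates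
both the coefficient and the inner product, and the factor `i` turns this into a change of sign of
the real part. -/
theorem IsTrigPoly.triTerm_comm {F : Finset (Fin d → ℤ)} {v : Field d} (hv : IsTrigPoly F v)
    {m₂ : (Fin d → ℤ) → ℝ} (hm₂ : ∀ k, m₂ (-k) = m₂ k) (k l : Fin d → ℤ) :
    triTerm m₂ v l k = -triTerm m₂ v k l := by
  have h1 : v (l - k) = conjVec (v (k - l)) := by rw [← hv.real, neg_sub]
  have h2 : m₂ (l - k) = m₂ (k - l) := by rw [← hm₂, neg_sub]
  have h3 : dotFreq (v (l - k)) l / (m₂ (l - k) : ℂ) =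
      starRingEnd ℂ (dotFreq (v (k - l)) k / (m₂ (k - l) : ℂ)) := by
    rw [h1, h2, dotFreq_conjVec, hv.dotFreq_sub k l, map_div₀, Complex.conj_ofReal]
  rw [triTerm, triTerm, h3, inner_smul_right, inner_smul_right, inner_smul_right, inner_smul_right,
    ← inner_conj_symm (v l) (v k)]
  generalize inner ℂ (v k) (v l) = z
  generalize dotFreq (v (k - l)) k / (m₂ (k - l) : ℂ) = w
  rw [← map_mul]
  simp
  ring

theorem IsTrigPoly.abs_triTerm_le {F : Finset (Fin d → ℤ)} {v : Field d} (hv : IsTrigPoly F v)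
    {m₂ : (Fin d → ℤ) → ℝ} {c : ℝ} (hc : 0 < c) (hm₂ : ∀ k, k ≠ 0 → c ≤ m₂ k)
    (k l : Fin d → ℤ) :
    |triTerm m₂ v k l| ≤ c⁻¹ * min (freqNorm k) (freqNorm l) * (‖v (k - l)‖ * ‖v k‖ * ‖v l‖) := by
  have h1 : ‖dotFreq (v (k - l)) k / (m₂ (k - l) : ℂ)‖ ≤
      c⁻¹ * min (freqNorm k) (freqNorm l) * ‖v (k - l)‖ := by
    rcases min_choice (freqNorm k) (freqNorm l) with h | h <;> rw [h]
    · exact norm_dotFreq_div_le hc hm₂ hv.meanZero _ _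
    · rw [hv.dotFreq_sub]
      exact norm_dotFreq_div_le hc hm₂ hv.meanZero _ _
  calc |triTerm m₂ v k l| ≤ ‖v k‖ * ‖Complex.I • ((dotFreq (v (k - l)) k / (m₂ (k - l) : ℂ)) • v l)‖ :=
        (Complex.abs_re_le_norm _).trans (norm_inner_le_norm _ _)
    _ = ‖v k‖ * (‖dotFreq (v (k - l)) k / (m₂ (k - l) : ℂ)‖ * ‖v l‖) := by
        rw [norm_smul, norm_smul, Complex.norm_I, one_mul]
    _ ≤ ‖v k‖ * ((c⁻¹ * min (freqNorm k) (freqNorm l) * ‖v (k - l)‖) * ‖v l‖) := by gcongr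
    _ = _ := by ring

/-- Antisymmetry replaces twice the weighted sum by one with the commutator `W k - W l`. Each of the
three terms of `commBound` leaves one factor `|·|‖v‖`, summed in `ℓ¹`, and two factors `√W ‖v‖`,
summed in `ℓ²`, so Young's inequality applies three times. -/
theorem IsTrigPoly.abs_sum_triTerm_le {F : Finset (Fin d → ℤ)} (hF : 0 ∉ F) {v : Field d}
    (hv : IsTrigPoly F v) {m₂ : (Fin d → ℤ) → ℝ} (hm₂e : ∀ k, m₂ (-k) = m₂ k) {c : ℝ} (hc : 0 < c)
    (hm₂ : ∀ k, k ≠ 0 → c ≤ m₂ k) {n : ℕ} {W : (Fin d → ℤ) → ℝ} (hW : IsWeight n W) :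
    2 * |∑ k ∈ F, W k * ∑ l ∈ F, triTerm m₂ v k l| ≤
      3 * 2 ^ n * c⁻¹ * (∑ k ∈ F, freqNorm k * ‖v k‖) * ∑ k ∈ F, W k * ‖v k‖ ^ 2 := by
  have h0 : ∀ k ∈ F, k ≠ 0 := fun k hk h => hF (h ▸ hk)
  have h1 : 2 * ∑ k ∈ F, W k * ∑ l ∈ F, triTerm m₂ v k l =
      ∑ k ∈ F, ∑ l ∈ F, (W k - W l) * triTerm m₂ v k l := by
    have h2 : ∑ k ∈ F, ∑ l ∈ F, W l * triTerm m₂ v k l =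
        -∑ k ∈ F, ∑ l ∈ F, W k * triTerm m₂ v k l := by
      rw [Finset.sum_comm]
      simp only [← Finset.sum_neg_distrib]
      refine Finset.sum_congr rfl fun k _ => Finset.sum_congr rfl fun l _ => ?_
      rw [hv.triTerm_comm hm₂e k l, mul_neg]
    simp only [sub_mul, Finset.sum_sub_distrib, h2]
    rw [two_mul, sub_neg_eq_add]
    simp only [Finset.mul_sum]
  set a : (Fin d → ℤ) → ℝ := fun k => freqNorm k * ‖v k‖ with ha_def
  set b : (Fin d → ℤ) → ℝ := fun k => √(W k) * ‖v k‖ with hb_def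
  have ha : ∀ k, 0 ≤ a k := fun k => mul_nonneg (freqNorm_nonneg k) (norm_nonneg _)
  have haF : ∀ k, k ∉ F → a k = 0 := fun k hk => by simp [ha_def, hv.supp k hk]
  have hbF : ∀ k, k ∉ F → b k = 0 := fun k hk => by simp [hb_def, hv.supp k hk]
  have hb2 : ∑ k ∈ F, b k ^ 2 = ∑ k ∈ F, W k * ‖v k‖ ^ 2 := by
    refine Finset.sum_congr rfl fun k _ => ?_
    rw [hb_def, mul_pow, Real.sq_sqrt (hW.nonneg k)]
  have h3 : ∀ k ∈ F, ∀ l ∈ F, |(W k - W l) * triTerm m₂ v k l| ≤ 2 ^ n * c⁻¹ *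
      (a (k - l) * b k * b l + a l * b (k - l) * b k + a k * b (k - l) * b l) := by
    intro k hk l hl
    have h4 := hW.abs_sub_mul_min_le (h0 k hk) (h0 l hl)
    calc |(W k - W l) * triTerm m₂ v k l| = |W k - W l| * |triTerm m₂ v k l| := abs_mul _ _
      _ ≤ |W k - W l| *
          (c⁻¹ * min (freqNorm k) (freqNorm l) * (‖v (k - l)‖ * ‖v k‖ * ‖v l‖)) := by
          gcongr
          exact hv.abs_triTerm_le hc hm₂ k l
      _ = c⁻¹ * (|W k - W l| * min (freqNorm k) (freqNorm l)) *
          (‖v (k - l)‖ * ‖v k‖ * ‖v l‖) := by ring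
      _ ≤ c⁻¹ * (2 ^ n * commBound W k l) * (‖v (k - l)‖ * ‖v k‖ * ‖v l‖) := by gcongr
      _ = _ := by simp only [commBound, ha_def, hb_def]; ring
  calc 2 * |∑ k ∈ F, W k * ∑ l ∈ F, triTerm m₂ v k l|
      = |∑ k ∈ F, ∑ l ∈ F, (W k - W l) * triTerm m₂ v k l| := by
        rw [← h1, abs_mul, abs_two]
    _ ≤ ∑ k ∈ F, ∑ l ∈ F, |(W k - W l) * triTerm m₂ v k l| :=
        (Finset.abs_sum_le_sum_abs _ _).trans
          (Finset.sum_le_sum fun k _ => Finset.abs_sum_le_sum_abs _ _)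
    _ ≤ ∑ k ∈ F, ∑ l ∈ F, 2 ^ n * c⁻¹ *
        (a (k - l) * b k * b l + a l * b (k - l) * b k + a k * b (k - l) * b l) :=
        Finset.sum_le_sum fun k hk => Finset.sum_le_sum fun l hl => h3 k hk l hl
    _ = 2 ^ n * c⁻¹ * (∑ k ∈ F, ∑ l ∈ F, a (k - l) * b k * b l +
        ∑ k ∈ F, ∑ l ∈ F, a l * b (k - l) * b k + ∑ k ∈ F, ∑ l ∈ F, a k * b (k - l) * b l) := by
        simp only [← Finset.mul_sum, Finset.sum_add_distrib]
    _ ≤ 2 ^ n * c⁻¹ * ((∑ k ∈ F, a k) * ∑ k ∈ F, b k ^ 2 + (∑ k ∈ F, a k) * ∑ k ∈ F, b k ^ 2 +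
        (∑ k ∈ F, a k) * ∑ k ∈ F, b k ^ 2) := by
        gcongr
        · exact sum_conv_le ha haF
        · exact sum_conv_le' ha hbF
        · exact sum_conv_le'' ha hbF
    _ = _ := by rw [hb2]; ring

theorem leray_zero (k : Fin d → ℤ) : leray k 0 = 0 := by
  rw [← lerayL_apply, map_zero]

/-- The substitution `h = k - l` indexes the sum by the frequency of the transported field, the form
in which the skew symmetry is visible. -/
theorem vectorField_eq_sum {F : Finset (Fin d → ℤ)} {v : Field d} (hv : ∀ k, k ∉ F → v k = 0)
    (m₁ m₂ : (Fin d → ℤ) → ℝ) (k : Fin d → ℤ) :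
    vectorField m₁ m₂ v k = -((m₁ k : ℂ) • v k) - Complex.I •
      ∑ l ∈ F, (dotFreq (v (k - l)) k / (m₂ (k - l) : ℂ)) • leray k (v l) := by
  rw [vectorField, ← (Equiv.subLeft k).tsum_eq]
  simp only [Equiv.subLeft_apply, sub_sub_cancel]
  rw [tsum_eq_sum (s := F) fun l hl => by rw [hv l hl, leray_zero, smul_zero]]

theorem IsTrigPoly.energy_rate_le {F : Finset (Fin d → ℤ)} (hF : 0 ∉ F) {v : Field d}
    (hv : IsTrigPoly F v) {m₁ m₂ : (Fin d → ℤ) → ℝ} (hm₁ : ∀ k, k ≠ 0 → 0 ≤ m₁ k)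
    (hm₂e : ∀ k, m₂ (-k) = m₂ k) {c : ℝ} (hc : 0 < c)
    (hm₂ : ∀ k, k ≠ 0 → c ≤ m₂ k) {n : ℕ} {W : (Fin d → ℤ) → ℝ} (hW : IsWeight n W) :
    ∑ k ∈ F, W k * (2 * (inner ℂ (v k) (vectorField m₁ m₂ v k)).re) ≤
      3 * 2 ^ n * c⁻¹ * (∑ k ∈ F, freqNorm k * ‖v k‖) * ∑ k ∈ F, W k * ‖v k‖ ^ 2 := by
  have h1 : ∀ k ∈ F, W k * (2 * (inner ℂ (v k) (vectorField m₁ m₂ v k)).re) ≤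
      -2 * (W k * ∑ l ∈ F, triTerm m₂ v k l) := by
    intro k hk
    have hk0 : k ≠ 0 := fun h => hF (h ▸ hk)
    have h2 : (inner ℂ (v k) (vectorField m₁ m₂ v k)).re =
        -(m₁ k * ‖v k‖ ^ 2) - ∑ l ∈ F, triTerm m₂ v k l := by
      rw [vectorField_eq_sum hv.supp, inner_sub_right, inner_neg_right, inner_smul_right,
        inner_self_eq_norm_sq_to_K, Complex.sub_re, Finset.smul_sum, inner_sum, Complex.re_sum]
      congr 1
      · rw [Complex.neg_re, Complex.re_ofReal_mul]
        norm_cast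
      · refine Finset.sum_congr rfl fun l _ => ?_
        rw [triTerm, inner_smul_right, inner_smul_right, inner_smul_right, inner_smul_right,
          inner_leray (hv.divFree k)]
    rw [h2]
    -- The dissipative term is discarded by its sign.
    nlinarith [mul_nonneg (hW.nonneg k) (mul_nonneg (hm₁ k hk0) (sq_nonneg ‖v k‖))]
  refine (Finset.sum_le_sum h1).trans ?_
  rw [← Finset.mul_sum]
  refine le_trans ?_ (hv.abs_sum_triTerm_le hF hm₂e hc hm₂ hW)
  linarith [neg_abs_le (∑ k ∈ F, W k * ∑ l ∈ F, triTerm m₂ v k l)]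

/-! ### Summability over the lattice -/

/-- Comparison with the lattice `ℤ^d` in `Fin d → ℝ`, which carries the sup norm. That norm is at
most the Euclidean one, and the exponent is negative. -/
theorem summable_freqNorm_rpow {r : ℝ} (hr : r < -d) :
    Summable fun k : Fin d → ℤ => freqNorm k ^ r := by
  classical
  let L := Submodule.span ℤ (Set.range (Pi.basisFun ℝ (Fin d)))
  have hrank : Module.finrank ℤ L = d := by
    rw [ZLattice.rank ℝ L]
    simp
  have h1 := ZLattice.summable_norm_rpow L r (by rw [hrank]; exact hr)
  have hmem : ∀ k : Fin d → ℤ, (fun i => (k i : ℝ)) ∈ L := by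
    intro k
    have : (fun i => (k i : ℝ)) = ∑ i, k i • Pi.basisFun ℝ (Fin d) i := by
      ext j
      simp [Pi.single_apply]
    rw [this]
    exact Submodule.sum_mem _ fun i _ =>
      Submodule.smul_mem _ _ (Submodule.subset_span (Set.mem_range_self i))
  let φ : (Fin d → ℤ) → L := fun k => ⟨_, hmem k⟩
  have hφ : Function.Injective φ := by
    intro k l h
    ext i
    have : (k i : ℝ) = l i := congrFun (congrArg Subtype.val h) i
    exact_mod_cast this
  refine Summable.of_nonneg_of_le (fun k => Real.rpow_nonneg (freqNorm_nonneg k) _) (fun k => ?_)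
    (h1.comp_injective hφ)
  rcases eq_or_ne k 0 with rfl | hk
  · have : φ 0 = 0 := by ext i; simp [φ]
    simp [this, freqNorm_zero]
  have h3 : 0 < ‖φ k‖ := by
    rw [norm_pos_iff]
    intro h0
    apply hk
    ext i
    have : (k i : ℝ) = 0 := congrFun (congrArg Subtype.val h0) i
    exact_mod_cast this
  have h4 : ‖φ k‖ ≤ freqNorm k := by
    change ‖fun i => (k i : ℝ)‖ ≤ _
    rw [pi_norm_le_iff_of_nonneg (freqNorm_nonneg k), freqNorm_eq_norm]
    exact fun i => PiLp.norm_apply_le (WithLp.toLp 2 fun i => (k i : ℝ) : EuclideanSpace ℝ (Fin d)) i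
  have hd : (0 : ℝ) ≤ d := Nat.cast_nonneg d
  exact Real.rpow_le_rpow_of_nonpos h3 h4 (by linarith)

/-- The terms are at most `|k|^(2 - 2γ)`, and `2 - 2γ < -d`. By Cauchy–Schwarz this makes `∑
|k||v_k|` a quantity controlled in `H^γ`. -/
theorem summable_freqNorm_sq_div {γ : ℝ} (hγ : 2 + (d : ℝ) / 2 ≤ γ) :
    Summable fun k : Fin d → ℤ => freqNorm k ^ 2 / sobWeight γ k := by
  have hd : (0 : ℝ) ≤ d := Nat.cast_nonneg d
  refine Summable.of_nonneg_of_le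
    (fun k => div_nonneg (sq_nonneg _) (sobWeight_pos γ k).le) (fun k => ?_)
    (summable_freqNorm_rpow (d := d) (r := 2 - 2 * γ) (by linarith))
  rcases eq_or_ne k 0 with rfl | hk
  · simp only [freqNorm_zero]
    rw [zero_pow two_ne_zero, zero_div]
    positivity
  have h1 := one_le_freqNorm hk
  have h0 : 0 < freqNorm k := by linarith
  rw [Real.rpow_sub h0, Real.rpow_two]
  have h2 : freqNorm k ^ (2 * γ) ≤ sobWeight γ k := by
    rw [Real.rpow_mul h0.le, Real.rpow_two, sobWeight]
    exact Real.rpow_le_rpow (by positivity) (by linarith) (by linarith)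
  gcongr

theorem sum_freqNorm_mul_norm_le {γ : ℝ} (hγ : 2 + (d : ℝ) / 2 ≤ γ) (F : Finset (Fin d → ℤ))
    (v : Field d) : ∑ k ∈ F, freqNorm k * ‖v k‖ ≤
      √(∑' k : Fin d → ℤ, freqNorm k ^ 2 / sobWeight γ k) * √(∑ k ∈ F, sobWeight γ k * ‖v k‖ ^ 2) := by
  have h1 : ∀ k, 0 ≤ freqNorm k ^ 2 / sobWeight γ k := fun k : Fin d → ℤ =>
    div_nonneg (sq_nonneg _) (sobWeight_pos γ k).le
  have h2 : ∀ k, 0 ≤ sobWeight γ k * ‖v k‖ ^ 2 := fun k =>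
    mul_nonneg (sobWeight_pos γ k).le (sq_nonneg _)
  calc ∑ k ∈ F, freqNorm k * ‖v k‖
      = ∑ k ∈ F, √(freqNorm k ^ 2 / sobWeight γ k) * √(sobWeight γ k * ‖v k‖ ^ 2) := by
        refine Finset.sum_congr rfl fun k _ => ?_
        have := sobWeight_pos γ k
        rw [← Real.sqrt_mul (h1 k), div_mul_eq_mul_div, mul_left_comm, mul_div_cancel_left₀ _ this.ne',
          ← mul_pow, Real.sqrt_sq (mul_nonneg (freqNorm_nonneg k) (norm_nonneg _))]
    _ ≤ √(∑ k ∈ F, freqNorm k ^ 2 / sobWeight γ k) * √(∑ k ∈ F, sobWeight γ k * ‖v k‖ ^ 2) :=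
        Real.sum_sqrt_mul_sqrt_le _ h1 h2
    _ ≤ _ := by
        gcongr
        exact (summable_freqNorm_sq_div hγ).sum_le_tsum _ fun k _ => h1 k

/-! ### Ordinary differential equations -/

/-- A `C¹` vector field on a finite-dimensional space has a solution on `[0, τ]` if the solutions of
all its time changes `χ f` with `0 ≤ χ ≤ 1` satisfy a common bound. -/
theorem exists_solution_of_bound {E : Type*} [NormedAddCommGroup E] [NormedSpace ℝ E]
    [FiniteDimensional ℝ E] {f : E → E} (hf : ContDiff ℝ 1 f) (x₀ : E) {τ R : ℝ} (hτ : 0 ≤ τ)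
    (hR : ∀ (χ : ℝ → ℝ) (x : ℝ → E), (∀ t, χ t ∈ Icc (0 : ℝ) 1) → x 0 = x₀ →
      (∀ t ∈ Icc 0 τ, HasDerivWithinAt x (χ t • f (x t)) (Icc 0 τ) t) →
      ∀ t ∈ Icc 0 τ, ‖x t‖ ≤ R) :
    ∃ x : ℝ → E, x 0 = x₀ ∧ ∀ t ∈ Icc 0 τ, HasDerivWithinAt x (f (x t)) (Icc 0 τ) t := by
  have : CompleteSpace E := FiniteDimensional.complete ℝ E
  -- Cutting off outside a ball that contains the a priori bound makes the field bounded and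
  -- globally Lipschitz, so Picard–Lindelöf reaches time `τ` at once.
  let ρ : ContDiffBump (0 : E) := ⟨max R 0 + 1, max R 0 + 2, by positivity, by linarith⟩
  have hρ : ContDiff ℝ 1 fun x => ρ x • f x := ρ.contDiff.smul hf
  have hρc : HasCompactSupport fun x => ρ x • f x := ρ.hasCompactSupport.smul_right
  obtain ⟨K, hK⟩ := hρ.lipschitzWith_of_hasCompactSupport hρc one_ne_zero
  obtain ⟨B, hB⟩ := hρ.continuous.bounded_above_of_compact_support hρc
  have hB0 : 0 ≤ B := (norm_nonneg _).trans (hB 0)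
  have hpl : IsPicardLindelof (fun _ x => ρ x • f x) (⟨0, le_rfl, hτ⟩ : Icc 0 τ) x₀
      ⟨B * τ, by positivity⟩ 0 ⟨B, hB0⟩ K := by
    refine IsPicardLindelof.of_time_independent (fun x _ => hB x) (hK.lipschitzOnWith) ?_
    change B * max (τ - 0) (0 - 0) ≤ B * τ - 0
    rw [sub_zero, sub_zero, sub_zero, max_eq_left hτ]
  obtain ⟨x, hx0, hx⟩ := hpl.exists_eq_forall_mem_Icc_hasDerivWithinAt₀
  -- The cut-off solution is a time change of a true one, with `χ = ρ ∘ x`. The bound thus keeps it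
  -- where `ρ = 1`.
  have hbd := hR (fun t => ρ (x t)) x (fun t => ⟨ρ.nonneg, ρ.le_one⟩) hx0 hx
  refine ⟨x, hx0, fun t ht => ?_⟩
  have h1 : ρ (x t) = 1 := by
    apply ρ.one_of_mem_closedBall
    rw [mem_closedBall_zero_iff]
    exact (hbd t ht).trans ((le_max_left R 0).trans (by simp [ρ]))
  have := hx t ht
  rwa [h1, one_smul] at this

theorem le_exp_mul_of_deriv_le {E E' : ℝ → ℝ} {τ K : ℝ}
    (hE : ∀ t ∈ Icc 0 τ, HasDerivWithinAt E (E' t) (Icc 0 τ) t)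
    (hE' : ∀ t ∈ Icc 0 τ, E' t ≤ K * E t) {t : ℝ} (ht : t ∈ Icc 0 τ) :
    E t ≤ Real.exp (K * t) * E 0 := by
  have h1 : ∀ s ∈ Icc 0 τ, HasDerivWithinAt (fun s => Real.exp (-(K * s)) * E s)
      (Real.exp (-(K * s)) * (-(K * 1)) * E s + Real.exp (-(K * s)) * E' s) (Icc 0 τ) s :=
    fun s hs => (((hasDerivWithinAt_id s _).const_mul K).neg.exp).mul (hE s hs)
  have h2 : AntitoneOn (fun s => Real.exp (-(K * s)) * E s) (Icc 0 τ) :=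
    antitoneOn_of_hasDerivWithinAt_nonpos (convex_Icc 0 τ) (fun s hs => (h1 s hs).continuousWithinAt)
      (fun s hs => (h1 s (interior_subset hs)).mono interior_subset) fun s hs => by
        nlinarith [Real.exp_pos (-(K * s)), hE' s (interior_subset hs)]
  have h3 := h2 (left_mem_Icc.2 (ht.1.trans ht.2)) ht ht.1
  simp only [mul_zero, neg_zero, Real.exp_zero, one_mul] at h3
  calc E t = Real.exp (K * t) * (Real.exp (-(K * t)) * E t) := by
        rw [← mul_assoc, ← Real.exp_add, add_neg_cancel, Real.exp_zero, one_mul]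
    _ ≤ _ := by gcongr

/-- Because `E' ≤ A (E + 1)^{3/2}`, the function `(E + 1)^{-1/2} + A t / 2` is non-decreasing. The
condition on `τ` stops at half of the guaranteed lifetime, where `(E + 1)^{-1/2}` has lost at most
half of the lower bound `(Q + 1)^{-1/2}`; squaring gives the factor 4. The added 1 keeps the inverse
root smooth at `E = 0`. -/
theorem le_of_deriv_le_mul_sqrt {E E' : ℝ → ℝ} {τ A Q : ℝ} (hA : 0 ≤ A)
    (hE : ∀ t ∈ Icc 0 τ, HasDerivWithinAt E (E' t) (Icc 0 τ) t)
    (hE0 : ∀ t ∈ Icc 0 τ, 0 ≤ E t)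
    (hE' : ∀ t ∈ Icc 0 τ, E' t ≤ A * √(E t) * E t) (hQ : E 0 ≤ Q) (hτ : A * τ ≤ (√(Q + 1))⁻¹)
    {t : ℝ} (ht : t ∈ Icc 0 τ) : E t ≤ 4 * (Q + 1) := by
  have h0 : (0 : ℝ) ∈ Icc 0 τ := left_mem_Icc.2 (ht.1.trans ht.2)
  have h1 : ∀ s ∈ Icc 0 τ, HasDerivWithinAt (fun s => (√(E s + 1))⁻¹ + A / 2 * s)
      (-(E' s / (2 * √(E s + 1))) / √(E s + 1) ^ 2 + A / 2 * 1) (Icc 0 τ) s := by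
    intro s hs
    have := hE0 s hs
    exact ((((hE s hs).add_const 1).sqrt (by positivity)).inv (by positivity)).add
      ((hasDerivWithinAt_id s _).const_mul _)
  have h2 : MonotoneOn (fun s => (√(E s + 1))⁻¹ + A / 2 * s) (Icc 0 τ) :=
    monotoneOn_of_hasDerivWithinAt_nonneg (convex_Icc 0 τ)
      (fun s hs => (h1 s hs).continuousWithinAt)
      (fun s hs => (h1 s (interior_subset hs)).mono interior_subset) fun s hs => by
        have hs' := interior_subset hs
        have h3 := hE0 s hs'
        have h4 : E' s ≤ A * √(E s + 1) * √(E s + 1) ^ 2 := by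
          rw [Real.sq_sqrt (by positivity)]
          refine (hE' s hs').trans ?_
          gcongr <;> linarith
        have h5 : 0 < √(E s + 1) := by positivity
        have h6 : E' s / (2 * √(E s + 1)) / √(E s + 1) ^ 2 ≤ A / 2 := by
          rw [div_div, div_le_iff₀ (by positivity)]
          linarith
        rw [neg_div]
        linarith
  have h3 := h2 h0 ht ht.1
  have hQ0 : 0 ≤ Q := (hE0 0 h0).trans hQ
  have hEt := hE0 t ht
  have h4 : (√(Q + 1))⁻¹ ≤ (√(E 0 + 1))⁻¹ := by
    have := hE0 0 h0
    gcongr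
  have h5 : A * t ≤ A * τ := mul_le_mul_of_nonneg_left ht.2 hA
  have h6 : (√(Q + 1))⁻¹ / 2 ≤ (√(E t + 1))⁻¹ := by
    simp only [mul_zero, add_zero] at h3
    linarith
  have h7 : √(E t + 1) ≤ 2 * √(Q + 1) := by
    have h8 : (2 * √(Q + 1))⁻¹ ≤ (√(E t + 1))⁻¹ := by
      rw [mul_inv]; linarith
    exact (inv_le_inv₀ (by positivity) (by positivity)).1 h8
  have h8 : E t + 1 ≤ (2 * √(Q + 1)) ^ 2 := (Real.sqrt_le_left (by positivity)).1 h7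
  rw [mul_pow, Real.sq_sqrt (by positivity)] at h8
  linarith

/-! ### Galerkin approximations -/

theorem IsTrigPoly.vectorField_neg {F : Finset (Fin d → ℤ)} (hFs : ∀ k ∈ F, -k ∈ F) {v : Field d}
    (hv : IsTrigPoly F v) {m₁ m₂ : (Fin d → ℤ) → ℝ} (hm₁e : ∀ k, m₁ (-k) = m₁ k)
    (hm₂e : ∀ k, m₂ (-k) = m₂ k) (k : Fin d → ℤ) :
    vectorField m₁ m₂ v (-k) = conjVec (vectorField m₁ m₂ v k) := by
  have h : ∑ l ∈ F, (dotFreq (v (-k - l)) (-k) / (m₂ (-k - l) : ℂ)) • leray (-k) (v l) =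
      -∑ l ∈ F, conjVec ((dotFreq (v (k - l)) k / (m₂ (k - l) : ℂ)) • leray k (v l)) := by
    rw [← Finset.sum_neg_distrib]
    refine Finset.sum_nbij' (fun l => -l) (fun l => -l) hFs hFs (fun l _ => neg_neg l)
      (fun l _ => neg_neg l) fun l _ => ?_
    have h1 : -k - l = -(k - -l) := by abel
    have h2 : v l = conjVec (v (-l)) := by rw [← hv.real, neg_neg]
    rw [h1, hm₂e, hv.real, dotFreq_neg_right, dotFreq_conjVec, conjVec_smul, leray_neg, h2,
      leray_conjVec, map_div₀, Complex.conj_ofReal, neg_div, neg_smul]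
  rw [vectorField_eq_sum hv.supp, vectorField_eq_sum hv.supp, conjVec_sub, conjVec_neg,
    conjVec_smul, conjVec_smul, conjVec_sum, hm₁e, hv.real, Complex.conj_ofReal, Complex.conj_I,
    neg_smul, h, smul_neg]

theorem dotFreq_vectorField {F : Finset (Fin d → ℤ)} {v : Field d} (hv : IsTrigPoly F v)
    (m₁ m₂ : (Fin d → ℤ) → ℝ) {k : Fin d → ℤ} (hk : k ≠ 0) :
    dotFreq (vectorField m₁ m₂ v k) k = 0 := by
  rw [vectorField_eq_sum hv.supp, ← dotFreqL_apply]
  simp only [map_sub, map_neg, map_smul, map_sum, dotFreqL_apply, hv.divFree k, dotFreq_leray hk,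
    smul_zero, Finset.sum_const_zero, neg_zero, sub_zero]

/-- Extension by zero of a family of coefficients. -/
noncomputable def extend (F : Finset (Fin d → ℤ)) (x : F → EuclideanSpace ℂ (Fin d)) : Field d :=
  fun k => if h : k ∈ F then x ⟨k, h⟩ else 0

theorem extend_coe {F : Finset (Fin d → ℤ)} (x : F → EuclideanSpace ℂ (Fin d)) (k : F) :
    extend F x k = x k := by
  simp [extend]

theorem extend_of_mem {F : Finset (Fin d → ℤ)} (x : F → EuclideanSpace ℂ (Fin d))
    {k : Fin d → ℤ} (hk : k ∈ F) : extend F x k = x ⟨k, hk⟩ := by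
  simp [extend, hk]

theorem extend_of_notMem {F : Finset (Fin d → ℤ)} (x : F → EuclideanSpace ℂ (Fin d))
    {k : Fin d → ℤ} (hk : k ∉ F) : extend F x k = 0 := by
  simp [extend, hk]

theorem extend_add {F : Finset (Fin d → ℤ)} (x y : F → EuclideanSpace ℂ (Fin d)) :
    extend F (x + y) = extend F x + extend F y := by
  ext1 k
  by_cases hk : k ∈ F <;> simp [extend, hk]

theorem extend_smul {F : Finset (Fin d → ℤ)} (a : ℝ) (x : F → EuclideanSpace ℂ (Fin d)) :
    extend F (a • x) = a • extend F x := by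
  ext1 k
  by_cases hk : k ∈ F <;> simp [extend, hk]

theorem extend_zero {F : Finset (Fin d → ℤ)} :
    extend F (0 : F → EuclideanSpace ℂ (Fin d)) = 0 := by
  ext1 k
  by_cases hk : k ∈ F <;> simp [extend, hk]

/-- The coefficients of the fields that satisfy `IsTrigPoly F`. -/
noncomputable def trigPoly (F : Finset (Fin d → ℤ)) :
    Submodule ℝ (F → EuclideanSpace ℂ (Fin d)) where
  carrier := {x | IsTrigPoly F (extend F x)}
  add_mem' := by
    intro x y hx hy
    have hx : IsTrigPoly F (extend F x) := hx
    have hy : IsTrigPoly F (extend F y) := hy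
    change IsTrigPoly F (extend F (x + y))
    rw [extend_add]
    refine ⟨fun k hk => ?_, fun k => ?_, fun k => ?_, ?_⟩
    · rw [Pi.add_apply, hx.supp k hk, hy.supp k hk, add_zero]
    · rw [Pi.add_apply, Pi.add_apply, hx.real, hy.real, conjVec_add]
    · have h1 := hx.divFree k
      have h2 := hy.divFree k
      rw [← dotFreqL_apply] at *
      rw [Pi.add_apply, map_add, h1, h2, add_zero]
    · rw [Pi.add_apply, hx.meanZero, hy.meanZero, add_zero]
  zero_mem' := by
    change IsTrigPoly F (extend F 0)
    rw [extend_zero]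
    exact ⟨fun k _ => rfl, fun k => conjVec_zero.symm, fun k => by simp [dotFreq], rfl⟩
  smul_mem' := by
    intro a x hx
    have hx : IsTrigPoly F (extend F x) := hx
    change IsTrigPoly F (extend F (a • x))
    rw [extend_smul]
    refine ⟨fun k hk => ?_, fun k => ?_, fun k => ?_, ?_⟩
    · rw [Pi.smul_apply, hx.supp k hk, smul_zero]
    · rw [Pi.smul_apply, Pi.smul_apply, hx.real, ← Complex.coe_smul, ← Complex.coe_smul,
        conjVec_smul, Complex.conj_ofReal]
    · have h1 := hx.divFree k
      rw [← dotFreqL_apply] at *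
      rw [Pi.smul_apply, ← Complex.coe_smul, map_smul, h1, smul_zero]
    · rw [Pi.smul_apply, hx.meanZero, smul_zero]

theorem mem_trigPoly {F : Finset (Fin d → ℤ)} {x : F → EuclideanSpace ℂ (Fin d)} :
    x ∈ trigPoly F ↔ IsTrigPoly F (extend F x) := Iff.rfl

/-- The vector field of the Galerkin approximation. -/
noncomputable def galerkinField (m₁ m₂ : (Fin d → ℤ) → ℝ) (F : Finset (Fin d → ℤ))
    (x : F → EuclideanSpace ℂ (Fin d)) : F → EuclideanSpace ℂ (Fin d) :=
  fun k => vectorField m₁ m₂ (extend F x) k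

/-- Reality and incompressibility are preserved, so the system can be solved inside `trigPoly F`,
where the energy estimate holds. Reality needs `F` symmetric. -/
theorem galerkinField_mem {F : Finset (Fin d → ℤ)} (hF : 0 ∉ F) (hFs : ∀ k ∈ F, -k ∈ F)
    {m₁ m₂ : (Fin d → ℤ) → ℝ} (hm₁e : ∀ k, m₁ (-k) = m₁ k) (hm₂e : ∀ k, m₂ (-k) = m₂ k)
    {x : F → EuclideanSpace ℂ (Fin d)} (hx : x ∈ trigPoly F) :
    galerkinField m₁ m₂ F x ∈ trigPoly F := by
  have hx := mem_trigPoly.1 hx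
  refine mem_trigPoly.2 ⟨fun k hk => extend_of_notMem _ hk, fun k => ?_, fun k => ?_,
    extend_of_notMem _ hF⟩
  · by_cases hk : k ∈ F
    · rw [extend_of_mem _ hk, extend_of_mem _ (hFs k hk)]
      exact hx.vectorField_neg hFs hm₁e hm₂e k
    · rw [extend_of_notMem _ hk, extend_of_notMem _ fun h => hk (by simpa using hFs _ h),
        conjVec_zero]
  · by_cases hk : k ∈ F
    · rw [extend_of_mem _ hk]
      exact dotFreq_vectorField hx m₁ m₂ fun h => hF (h ▸ hk)
    · rw [extend_of_notMem _ hk]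
      simp [dotFreq]

theorem contDiff_extend {F : Finset (Fin d → ℤ)} (k : Fin d → ℤ) :
    ContDiff ℝ 1 fun x : F → EuclideanSpace ℂ (Fin d) => extend F x k := by
  by_cases hk : k ∈ F
  · simp only [extend_of_mem _ hk]
    fun_prop
  · simp only [extend_of_notMem _ hk]
    fun_prop

theorem contDiff_galerkinField (m₁ m₂ : (Fin d → ℤ) → ℝ) (F : Finset (Fin d → ℤ)) :
    ContDiff ℝ 1 (galerkinField m₁ m₂ F) := by
  rw [contDiff_pi]
  intro k
  have h1 : ∀ x, galerkinField m₁ m₂ F x k = -((m₁ k : ℂ) • extend F x k) - Complex.I •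
      ∑ l ∈ F, ((m₂ (k - l) : ℂ)⁻¹ * dotFreqL (k : Fin d → ℤ) (extend F x (k - l))) •
        lerayL (k : Fin d → ℤ) (extend F x l) := by
    intro x
    rw [galerkinField, vectorField_eq_sum (F := F) fun k hk => extend_of_notMem x hk]
    simp only [lerayL_apply, dotFreqL_apply, div_eq_inv_mul]
  simp only [h1]
  have h2 : ∀ l : Fin d → ℤ, ContDiff ℝ 1 fun x : F → EuclideanSpace ℂ (Fin d) =>
      dotFreqL (k : Fin d → ℤ) (extend F x l) := fun l =>
    ((dotFreqL (k : Fin d → ℤ)).restrictScalars ℝ).contDiff.comp (contDiff_extend l)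
  have h3 : ∀ l : Fin d → ℤ, ContDiff ℝ 1 fun x : F → EuclideanSpace ℂ (Fin d) =>
      lerayL (k : Fin d → ℤ) (extend F x l) := fun l =>
    ((lerayL (k : Fin d → ℤ)).restrictScalars ℝ).contDiff.comp (contDiff_extend l)
  exact ((contDiff_extend _).const_smul _).neg.sub
    ((ContDiff.sum fun l _ => (contDiff_const.mul (h2 _)).smul (h3 _)).const_smul _)

/-- The properties of the symbols `m₁` and `m₂` on which local existence depends. -/
structure IsSymbolPair (c : ℝ) (m₁ m₂ : (Fin d → ℤ) → ℝ) : Prop where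
  pos : 0 < c
  nonneg : ∀ k, k ≠ 0 → 0 ≤ m₁ k
  even₁ : ∀ k, m₁ (-k) = m₁ k
  le : ∀ k, k ≠ 0 → c ≤ m₂ k
  even₂ : ∀ k, m₂ (-k) = m₂ k

/-- The part of a weighted squared norm carried by the frequencies in `F`. -/
noncomputable def energy (F : Finset (Fin d → ℤ)) (W : (Fin d → ℤ) → ℝ) (v : Field d) : ℝ :=
  ∑ k ∈ F, W k * ‖v k‖ ^ 2

theorem energy_nonneg {F : Finset (Fin d → ℤ)} {W : (Fin d → ℤ) → ℝ} (hW : ∀ k, 0 ≤ W k)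
    (v : Field d) : 0 ≤ energy F W v :=
  Finset.sum_nonneg fun k _ => mul_nonneg (hW k) (sq_nonneg _)

/-- The constant of the energy estimate in `H^γ` for weights of growth `n`. -/
noncomputable def energyConst (d n : ℕ) (γ c : ℝ) : ℝ :=
  3 * 2 ^ n * c⁻¹ * √(∑' k : Fin d → ℤ, freqNorm k ^ 2 / sobWeight γ k)

theorem energyConst_nonneg (d n : ℕ) (γ : ℝ) {c : ℝ} (hc : 0 < c) : 0 ≤ energyConst d n γ c := by
  unfold energyConst
  positivity

/-- The upper bound is non-negative, so it survives multiplication of the rate by a time change `χ`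
in `[0, 1]`, as `exists_solution_of_bound` requires. -/
theorem IsTrigPoly.energy_rate_le' {F : Finset (Fin d → ℤ)} (hF : 0 ∉ F) {v : Field d}
    (hv : IsTrigPoly F v) {c : ℝ} {m₁ m₂ : (Fin d → ℤ) → ℝ} (hs : IsSymbolPair c m₁ m₂)
    {γ : ℝ} (hγ : 2 + (d : ℝ) / 2 ≤ γ) {n : ℕ} {W : (Fin d → ℤ) → ℝ} (hW : IsWeight n W)
    {χ : ℝ} (hχ : χ ∈ Icc (0 : ℝ) 1) :
    χ * ∑ k ∈ F, W k * (2 * (inner ℂ (v k) (vectorField m₁ m₂ v k)).re) ≤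
      energyConst d n γ c * √(energy F (sobWeight γ) v) * energy F W v := by
  have hc := hs.pos
  have h0 := energy_nonneg (F := F) hW.nonneg v
  have h1 : ∑ k ∈ F, W k * (2 * (inner ℂ (v k) (vectorField m₁ m₂ v k)).re) ≤
      energyConst d n γ c * √(energy F (sobWeight γ) v) * energy F W v := by
    refine (hv.energy_rate_le hF hs.nonneg hs.even₂ hs.pos hs.le hW).trans ?_
    unfold energyConst
    rw [mul_assoc _ √_ √_]
    change _ * energy F W v ≤ _
    gcongr
    exact sum_freqNorm_mul_norm_le hγ F v
  have h2 : 0 ≤ energyConst d n γ c * √(energy F (sobWeight γ) v) * energy F W v :=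
    mul_nonneg (mul_nonneg (energyConst_nonneg d n γ hc) (Real.sqrt_nonneg _)) h0
  nlinarith [mul_le_mul_of_nonneg_left h1 hχ.1, mul_nonneg (sub_nonneg.2 hχ.2) h2]

theorem hasDerivWithinAt_energy {F : Finset (Fin d → ℤ)} (W : (Fin d → ℤ) → ℝ) {v : ℝ → Field d}
    {S : Set ℝ} {t : ℝ} {χ : ℝ} {w : Field d}
    (hv : ∀ k ∈ F, HasDerivWithinAt (fun s => v s k) (χ • w k) S t) :
    HasDerivWithinAt (fun s => energy F W (v s))
      (χ * ∑ k ∈ F, W k * (2 * (inner ℂ (v t k) (w k)).re)) S t := by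
  unfold energy
  rw [Finset.mul_sum]
  refine HasDerivWithinAt.fun_sum fun k hk => ?_
  have h1 := (hv k hk).inner ℂ (hv k hk)
  have h2 := (Complex.reCLM.hasFDerivAt.comp_hasDerivWithinAt t h1).const_mul (W k)
  have h3 : (fun s => W k * ‖v s k‖ ^ 2) =
      fun s => W k * (Complex.reCLM ∘ fun s => inner ℂ (v s k) (v s k)) s := by
    ext s
    rw [Function.comp_apply, Complex.reCLM_apply, inner_self_eq_norm_sq_to_K]
    norm_cast
  rw [h3]
  refine h2.congr_deriv ?_
  rw [Complex.reCLM_apply, Complex.add_re, ← inner_conj_symm (χ • w k) (v t k), Complex.conj_re,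
    ← Complex.coe_smul, inner_smul_right, Complex.re_ofReal_mul]
  ring

/-- `v` solves the Galerkin system of `F` on `[0, τ]`, up to a change of time. -/
structure IsGalerkinPath (m₁ m₂ : (Fin d → ℤ) → ℝ) (F : Finset (Fin d → ℤ)) (τ : ℝ) (χ : ℝ → ℝ)
    (v : ℝ → Field d) : Prop where
  mem_Icc : ∀ t, χ t ∈ Icc (0 : ℝ) 1
  trigPoly : ∀ t ∈ Icc 0 τ, IsTrigPoly F (v t)
  deriv : ∀ t ∈ Icc 0 τ, ∀ k ∈ F,
    HasDerivWithinAt (fun s => v s k) (χ t • vectorField m₁ m₂ (v t) k) (Icc 0 τ) t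

theorem IsGalerkinPath.energy_le {c : ℝ} {m₁ m₂ : (Fin d → ℤ) → ℝ} (hs : IsSymbolPair c m₁ m₂)
    {F : Finset (Fin d → ℤ)} (hF : 0 ∉ F) {τ : ℝ} {χ : ℝ → ℝ} {v : ℝ → Field d}
    (hv : IsGalerkinPath m₁ m₂ F τ χ v) {γ : ℝ} (hγ : 2 + (d : ℝ) / 2 ≤ γ) {Q : ℝ}
    (hQ : energy F (sobWeight γ) (v 0) ≤ Q)
    (hτ : energyConst d ⌈2 * γ⌉₊ γ c * τ ≤ (√(Q + 1))⁻¹) {t : ℝ} (ht : t ∈ Icc 0 τ) :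
    energy F (sobWeight γ) (v t) ≤ 4 * (Q + 1) := by
  have hγ0 : 0 ≤ γ := by
    have : (0 : ℝ) ≤ d := Nat.cast_nonneg d
    linarith
  have hW := isWeight_sobWeight (d := d) hγ0 (Nat.le_ceil (2 * γ))
  exact le_of_deriv_le_mul_sqrt (E := fun t => energy F (sobWeight γ) (v t))
    (energyConst_nonneg d _ γ hs.pos)
    (fun t ht => hasDerivWithinAt_energy _ (hv.deriv t ht))
    (fun t _ => energy_nonneg hW.nonneg _)
    (fun t ht => (hv.trigPoly t ht).energy_rate_le' hF hs hγ hW (hv.mem_Icc t)) hQ hτ ht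

/-- Once the `H^γ` energy is bounded, every other weight obeys a linear Grönwall inequality, whose
constant depends on the weight only through its growth exponent, and not on `F`. -/
theorem IsGalerkinPath.weighted_energy_le {c : ℝ} {m₁ m₂ : (Fin d → ℤ) → ℝ}
    (hs : IsSymbolPair c m₁ m₂) {F : Finset (Fin d → ℤ)} (hF : 0 ∉ F) {τ : ℝ} {χ : ℝ → ℝ}
    {v : ℝ → Field d} (hv : IsGalerkinPath m₁ m₂ F τ χ v) {γ : ℝ} (hγ : 2 + (d : ℝ) / 2 ≤ γ) {Q : ℝ}
    (hQ : energy F (sobWeight γ) (v 0) ≤ Q)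
    (hτ : energyConst d ⌈2 * γ⌉₊ γ c * τ ≤ (√(Q + 1))⁻¹) {n : ℕ} {W : (Fin d → ℤ) → ℝ}
    (hW : IsWeight n W) {t : ℝ} (ht : t ∈ Icc 0 τ) :
    energy F W (v t) ≤
      Real.exp (energyConst d n γ c * √(4 * (Q + 1)) * τ) * energy F W (v 0) := by
  have hA := energyConst_nonneg d n γ hs.pos
  refine (le_exp_mul_of_deriv_le (E := fun t => energy F W (v t))
    (K := energyConst d n γ c * √(4 * (Q + 1)))
    (fun t ht => hasDerivWithinAt_energy _ (hv.deriv t ht)) (fun t ht => ?_) ht).trans ?_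
  · refine ((hv.trigPoly t ht).energy_rate_le' hF hs hγ hW (hv.mem_Icc t)).trans ?_
    have := energy_nonneg (F := F) hW.nonneg (v t)
    have := hv.energy_le hs hF hγ hQ hτ ht
    gcongr
  · have := energy_nonneg (F := F) hW.nonneg (v 0)
    have := ht.2
    gcongr

theorem exists_isGalerkinPath {c : ℝ} {m₁ m₂ : (Fin d → ℤ) → ℝ} (hs : IsSymbolPair c m₁ m₂)
    {F : Finset (Fin d → ℤ)} (hF : 0 ∉ F) (hFs : ∀ k ∈ F, -k ∈ F) {v₀ : Field d}
    (hv₀ : IsTrigPoly F v₀) {γ : ℝ} (hγ : 2 + (d : ℝ) / 2 ≤ γ) {Q : ℝ}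
    (hQ : energy F (sobWeight γ) v₀ ≤ Q) {τ : ℝ} (hτ0 : 0 ≤ τ)
    (hτ : energyConst d ⌈2 * γ⌉₊ γ c * τ ≤ (√(Q + 1))⁻¹) :
    ∃ v : ℝ → Field d, v 0 = v₀ ∧ IsGalerkinPath m₁ m₂ F τ (fun _ => 1) v := by
  have hγ0 : 0 ≤ γ := by
    have : (0 : ℝ) ≤ d := Nat.cast_nonneg d
    linarith
  have hx₀ : extend F (fun k => v₀ k) = v₀ := by
    ext1 k
    by_cases hk : k ∈ F
    · rw [extend_of_mem _ hk]
    · rw [extend_of_notMem _ hk, hv₀.supp k hk]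
  -- The projection only turns the field into a map with values in the subspace; by invariance it
  -- changes nothing.
  obtain ⟨P, hP⟩ := Submodule.ClosedComplemented.of_finiteDimensional (trigPoly (d := d) F)
  have hmem : ∀ x : trigPoly (d := d) F, galerkinField m₁ m₂ F x ∈ trigPoly F := fun x =>
    galerkinField_mem hF hFs hs.even₁ hs.even₂ x.2
  have hP' : ∀ x : trigPoly (d := d) F,
      ((P (galerkinField m₁ m₂ F x) : trigPoly (d := d) F) : F → EuclideanSpace ℂ (Fin d)) =
        galerkinField m₁ m₂ F x := fun x =>
    congrArg Subtype.val (hP ⟨_, hmem x⟩)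
  have key : ∀ (χ : ℝ → ℝ) (x : ℝ → trigPoly (d := d) F), (∀ t, χ t ∈ Icc (0 : ℝ) 1) →
      (∀ t ∈ Icc 0 τ, HasDerivWithinAt x (χ t • P (galerkinField m₁ m₂ F (x t))) (Icc 0 τ) t) →
      IsGalerkinPath m₁ m₂ F τ χ fun t => extend F (x t) := by
    intro χ x hχ hx
    refine ⟨hχ, fun t _ => mem_trigPoly.1 (x t).2, fun t ht k hk => ?_⟩
    have h1 := ((trigPoly (d := d) F).subtypeL.hasFDerivAt).comp_hasDerivWithinAt t (hx t ht)
    have h2 := (hasDerivWithinAt_pi.1 h1) ⟨k, hk⟩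
    simp only [extend_of_mem _ hk]
    refine h2.congr_deriv ?_
    rw [map_smul]
    simp only [Submodule.subtypeL_apply, hP', Pi.smul_apply, galerkinField]
  obtain ⟨x, hx0, hx⟩ := exists_solution_of_bound (E := trigPoly (d := d) F)
    (f := fun x => P (galerkinField m₁ m₂ F x))
    (P.contDiff.comp ((contDiff_galerkinField m₁ m₂ F).comp (trigPoly F).subtypeL.contDiff))
    ⟨fun k => v₀ k, by rw [mem_trigPoly, hx₀]; exact hv₀⟩ (R := √(4 * (Q + 1))) hτ0 (by
      intro χ x hχ hx0 hx t ht
      have h1 := key χ x hχ hx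
      have h2 : energy F (sobWeight γ) (extend F (x t)) ≤ 4 * (Q + 1) :=
        h1.energy_le hs hF hγ (by simp only [hx0, hx₀]; exact hQ) hτ ht
      change ‖(x t : F → EuclideanSpace ℂ (Fin d))‖ ≤ _
      rw [pi_norm_le_iff_of_nonneg (Real.sqrt_nonneg _)]
      intro k
      apply Real.le_sqrt_of_sq_le
      refine le_trans ?_ h2
      rw [← extend_coe (x t : F → EuclideanSpace ℂ (Fin d)) k]
      have h3 := Finset.single_le_sum
        (f := fun k => sobWeight γ k * ‖extend F (x t : F → EuclideanSpace ℂ (Fin d)) k‖ ^ 2)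
        (fun k _ => mul_nonneg (sobWeight_pos γ k).le (sq_nonneg _)) k.2
      refine le_trans ?_ h3
      exact le_mul_of_one_le_left (sq_nonneg _) (one_le_sobWeight hγ0 _))
  refine ⟨fun t => extend F (x t), ?_, key _ x (fun _ => ⟨zero_le_one, le_rfl⟩) ?_⟩
  · simp only [hx0, hx₀]
  · simpa only [one_smul] using hx

/-! ### Limits of solutions -/

/-- Joint convergence of the derivatives at `t` makes `f n s - s • g'` Lipschitz with constant `ε`
near `t`; the mean value inequality then passes to the limit pointwise. -/
theorem hasDerivWithinAt_of_tendsto {ι E : Type*} [NormedAddCommGroup E] [NormedSpace ℝ E]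
    {l : Filter ι} [l.NeBot] {f f' : ι → ℝ → E} {g : ℝ → E} {g' : E} {S : Set ℝ} (hS : Convex ℝ S)
    {t : ℝ} (ht : t ∈ S) (hf : ∀ᶠ n in l, ∀ s ∈ S, HasDerivWithinAt (f n) (f' n s) S s)
    (hf' : Tendsto (fun p : ι × ℝ => f' p.1 p.2) (l ×ˢ 𝓝[S] t) (𝓝 g'))
    (hg : ∀ s ∈ S, Tendsto (fun n => f n s) l (𝓝 (g s))) : HasDerivWithinAt g g' S t := by
  rw [hasDerivWithinAt_iff_isLittleO, Asymptotics.isLittleO_iff]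
  intro ε hε
  have h1 : ∀ᶠ p : ι × ℝ in l ×ˢ 𝓝[S] t, ‖f' p.1 p.2 - g'‖ ≤ ε := by
    filter_upwards [hf' (Metric.closedBall_mem_nhds g' hε)] with p hp
    rwa [mem_preimage, mem_closedBall_iff_norm] at hp
  obtain ⟨pa, hpa, pb, hpb, hp⟩ := eventually_prod_iff.1 h1
  obtain ⟨δ, hδ, hδp⟩ := Metric.mem_nhdsWithin_iff.1 hpb
  have hconv : Convex ℝ (Metric.ball t δ ∩ S) := (convex_ball t δ).inter hS
  have htm : t ∈ Metric.ball t δ ∩ S := ⟨Metric.mem_ball_self hδ, ht⟩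
  filter_upwards [inter_mem_nhdsWithin S (Metric.ball_mem_nhds t hδ)] with s hs
  have hsm : s ∈ Metric.ball t δ ∩ S := ⟨hs.2, hs.1⟩
  have h2 : ∀ᶠ n in l, ‖f n s - f n t - (s - t) • g'‖ ≤ ε * ‖s - t‖ := by
    filter_upwards [hf, hpa] with n hn hna
    have h3 : ∀ r ∈ Metric.ball t δ ∩ S, HasDerivWithinAt (fun r => f n r - r • g')
        (f' n r - (1 : ℝ) • g') (Metric.ball t δ ∩ S) r := fun r hr =>
      ((hn r hr.2).mono inter_subset_right).sub ((hasDerivWithinAt_id r _).smul_const g')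
    have h4 := hconv.norm_image_sub_le_of_norm_hasDerivWithin_le h3
      (fun r hr => by rw [one_smul]; exact hp hna (hδp hr)) htm hsm
    convert h4 using 2
    rw [sub_smul]
    abel
  exact le_of_tendsto ((((hg s hs.1).sub (hg t ht)).sub tendsto_const_nhds).norm) h2

/-- Dominated convergence: a common `ℓ²` majorant `b` bounds the convolution terms through `2 b_h
b_{k-h} ≤ b_h² + b_{k-h}²`. -/
theorem tendsto_vectorField {α : Type*} {l : Filter α} {c : ℝ} {m₁ m₂ : (Fin d → ℤ) → ℝ}
    (hs : IsSymbolPair c m₁ m₂) {x : α → Field d} {y : Field d}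
    (hx : ∀ k, Tendsto (fun a => x a k) l (𝓝 (y k))) {b : (Fin d → ℤ) → ℝ}
    (hb : Summable fun k => b k ^ 2) (hxb : ∀ᶠ a in l, x a 0 = 0 ∧ ∀ k, ‖x a k‖ ≤ b k)
    (k : Fin d → ℤ) :
    Tendsto (fun a => vectorField m₁ m₂ (x a) k) l (𝓝 (vectorField m₁ m₂ y k)) := by
  unfold vectorField
  refine (((hx k).const_smul _).neg).sub (Tendsto.const_smul ?_ _)
  have hb' : Summable fun h => b (k - h) ^ 2 := (Equiv.subLeft k).summable_iff.2 hb
  refine tendsto_tsum_of_dominated_convergence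
    (bound := fun h => c⁻¹ * freqNorm k * (b h ^ 2 + b (k - h) ^ 2))
    ((hb.add hb').mul_left _) (fun h => ?_) ?_
  · have h1 := ((dotFreqL k).continuous.tendsto _).comp (hx h)
    have h2 := ((lerayL k).continuous.tendsto _).comp (hx (k - h))
    simp only [Function.comp_def, dotFreqL_apply, lerayL_apply] at h1 h2
    exact (h1.div_const _).smul h2
  · filter_upwards [hxb] with a ha h
    have hc := hs.pos
    have hk := freqNorm_nonneg k
    calc ‖(dotFreq (x a h) k / (m₂ h : ℂ)) • leray k (x a (k - h))‖
        ≤ (c⁻¹ * freqNorm k * ‖x a h‖) * (2 * ‖x a (k - h)‖) := by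
          rw [norm_smul]
          have := norm_dotFreq_div_le hs.pos hs.le ha.1 h k
          have := norm_leray_le k (x a (k - h))
          gcongr
      _ ≤ (c⁻¹ * freqNorm k * b h) * (2 * b (k - h)) := by
          have := ha.2 h
          have := ha.2 (k - h)
          have := (norm_nonneg _).trans (ha.2 h)
          gcongr
      _ = c⁻¹ * freqNorm k * (2 * b h * b (k - h)) := by ring
      _ ≤ _ := by
          gcongr
          exact two_mul_le_add_sq _ _

theorem norm_vectorField_le {c : ℝ} {m₁ m₂ : (Fin d → ℤ) → ℝ}
    (hs : IsSymbolPair c m₁ m₂) {b : (Fin d → ℤ) → ℝ} (hb : Summable fun k => b k ^ 2)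
    (k : Fin d → ℤ) : ∃ L : ℝ, 0 ≤ L ∧ ∀ x : Field d, x 0 = 0 → (∀ k, ‖x k‖ ≤ b k) →
      ‖vectorField m₁ m₂ x k‖ ≤ L := by
  have hb' : Summable fun h => b (k - h) ^ 2 := (Equiv.subLeft k).summable_iff.2 hb
  have hsum := (hb.add hb').mul_left (c⁻¹ * freqNorm k)
  have hc := hs.pos
  have hk := freqNorm_nonneg k
  refine ⟨|m₁ k| * |b k| + ∑' h, c⁻¹ * freqNorm k * (b h ^ 2 + b (k - h) ^ 2), ?_, ?_⟩
  · have : 0 ≤ ∑' h, c⁻¹ * freqNorm k * (b h ^ 2 + b (k - h) ^ 2) :=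
      tsum_nonneg fun h => by positivity
    positivity
  intro x hx0 hx
  rw [vectorField]
  refine (norm_sub_le _ _).trans (add_le_add ?_ ?_)
  · rw [norm_neg, norm_smul, Complex.norm_real, Real.norm_eq_abs]
    gcongr
    exact (hx k).trans (le_abs_self _)
  · rw [norm_smul, Complex.norm_I, one_mul]
    refine tsum_of_norm_bounded hsum.hasSum fun h => ?_
    calc ‖(dotFreq (x h) k / (m₂ h : ℂ)) • leray k (x (k - h))‖
        ≤ (c⁻¹ * freqNorm k * ‖x h‖) * (2 * ‖x (k - h)‖) := by
          rw [norm_smul]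
          have := norm_dotFreq_div_le hs.pos hs.le hx0 h k
          have := norm_leray_le k (x (k - h))
          gcongr
      _ ≤ (c⁻¹ * freqNorm k * b h) * (2 * b (k - h)) := by
          have := hx h
          have := hx (k - h)
          have := (norm_nonneg _).trans (hx h)
          gcongr
      _ = c⁻¹ * freqNorm k * (2 * b h * b (k - h)) := by ring
      _ ≤ _ := by
          gcongr
          exact two_mul_le_add_sq _ _

/-! ### Sobolev norms -/

theorem sobTerm_nonneg (γ : ℝ) (v : Field d) (k : Fin d → ℤ) : 0 ≤ sobWeight γ k * ‖v k‖ ^ 2 :=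
  mul_nonneg (sobWeight_pos γ k).le (sq_nonneg _)

theorem norm_sub_sq_le {E : Type*} [SeminormedAddCommGroup E] (x y : E) :
    ‖x - y‖ ^ 2 ≤ 2 * (‖x‖ ^ 2 + ‖y‖ ^ 2) := by
  have := norm_sub_le x y
  nlinarith [norm_nonneg (x - y), sq_nonneg (‖x‖ - ‖y‖)]

theorem MemH.sub {γ : ℝ} {v w : Field d} (hv : MemH γ v) (hw : MemH γ w) :
    MemH γ fun k => v k - w k := by
  refine Summable.of_nonneg_of_le (sobTerm_nonneg γ _) (fun k => ?_) ((hv.add hw).mul_left 2)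
  nlinarith [mul_le_mul_of_nonneg_left (norm_sub_sq_le (v k) (w k)) (sobWeight_pos γ k).le]

theorem summable_sobInner {γ : ℝ} {v w : Field d} (hv : MemH γ v) (hw : MemH γ w) :
    Summable fun k => (sobWeight γ k : ℂ) * inner ℂ (w k) (v k) := by
  refine Summable.of_norm_bounded (hv.add hw) fun k => ?_
  have h0 := (sobWeight_pos γ k).le
  rw [norm_mul, Complex.norm_real, Real.norm_of_nonneg h0, ← mul_add]
  refine mul_le_mul_of_nonneg_left ((norm_inner_le_norm _ _).trans ?_) h0
  nlinarith [sq_nonneg (‖v k‖ - ‖w k‖), sq_nonneg (‖v k‖), sq_nonneg (‖w k‖)]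

theorem norm_sobInner_le {γ : ℝ} {v w : Field d} (hv : MemH γ v) (hw : MemH γ w) :
    ‖sobInner γ v w‖ ≤ √(sobNormSq γ w) * √(sobNormSq γ v) := by
  refine le_of_tendsto (summable_sobInner hv hw).hasSum.norm (Eventually.of_forall fun B => ?_)
  calc ‖∑ k ∈ B, (sobWeight γ k : ℂ) * inner ℂ (w k) (v k)‖
      ≤ ∑ k ∈ B, √(sobWeight γ k * ‖w k‖ ^ 2) * √(sobWeight γ k * ‖v k‖ ^ 2) := by
        refine (norm_sum_le _ _).trans (Finset.sum_le_sum fun k _ => ?_)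
        have h0 := (sobWeight_pos γ k).le
        rw [norm_mul, Complex.norm_real, Real.norm_of_nonneg h0, Real.sqrt_mul h0, Real.sqrt_mul h0,
          Real.sqrt_sq (norm_nonneg _), Real.sqrt_sq (norm_nonneg _), mul_mul_mul_comm,
          Real.mul_self_sqrt h0]
        exact mul_le_mul_of_nonneg_left (norm_inner_le_norm _ _) h0
    _ ≤ √(∑ k ∈ B, sobWeight γ k * ‖w k‖ ^ 2) * √(∑ k ∈ B, sobWeight γ k * ‖v k‖ ^ 2) :=
        Real.sum_sqrt_mul_sqrt_le _ (sobTerm_nonneg γ w) (sobTerm_nonneg γ v)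
    _ ≤ _ := by
        gcongr
        · exact hw.sum_le_tsum _ fun k _ => sobTerm_nonneg γ w k
        · exact hv.sum_le_tsum _ fun k _ => sobTerm_nonneg γ v k

theorem sobInner_sub {γ : ℝ} {v v' w : Field d} (hv : MemH γ v) (hv' : MemH γ v') (hw : MemH γ w) :
    sobInner γ v w - sobInner γ v' w = sobInner γ (fun k => v k - v' k) w := by
  rw [sobInner, sobInner, sobInner,
    ← (summable_sobInner hv hw).tsum_sub (summable_sobInner hv' hw)]
  simp only [inner_sub_right, mul_sub]

/-- Strong continuity in `H^γ` implies weak continuity. -/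
theorem continuousOn_sobInner {γ : ℝ} {v : ℝ → Field d} {S : Set ℝ} (hv : ∀ t ∈ S, MemH γ (v t))
    (hc : ∀ t ∈ S, Tendsto (fun s => sobNormSq γ fun k => v s k - v t k) (𝓝[S] t) (𝓝 0))
    {w : Field d} (hw : MemH γ w) : ContinuousOn (fun t => sobInner γ (v t) w) S := by
  intro t ht
  rw [ContinuousWithinAt, tendsto_iff_norm_sub_tendsto_zero]
  have h1 : Tendsto (fun s => √(sobNormSq γ w) * √(sobNormSq γ fun k => v s k - v t k))
      (𝓝[S] t) (𝓝 0) := by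
    simpa using ((Real.continuous_sqrt.tendsto _).comp (hc t ht)).const_mul √(sobNormSq γ w)
  refine squeeze_zero' (Eventually.of_forall fun _ => norm_nonneg _) ?_ h1
  filter_upwards [self_mem_nhdsWithin] with s hs
  rw [sobInner_sub (hv s hs) (hv t ht) hw]
  exact norm_sobInner_le ((hv s hs).sub (hv t ht)) hw

/-- Convergence of the coefficients and uniform smallness of the tails imply convergence in
`H^γ`. -/
theorem tendsto_sobNormSq {γ : ℝ} {v : ℝ → Field d} {S : Set ℝ} {t : ℝ} (ht : t ∈ S)
    (hc : ∀ k, ContinuousWithinAt (fun s => v s k) S t)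
    (htail : ∀ ε : ℝ, 0 < ε → ∃ A : Finset (Fin d → ℤ), ∀ s ∈ S, ∀ B : Finset (Fin d → ℤ),
      Disjoint B A → ∑ k ∈ B, sobWeight γ k * ‖v s k‖ ^ 2 ≤ ε) :
    Tendsto (fun s => sobNormSq γ fun k => v s k - v t k) (𝓝[S] t) (𝓝 0) := by
  have hnn : ∀ s, 0 ≤ sobNormSq γ fun k => v s k - v t k := fun s =>
    tsum_nonneg (sobTerm_nonneg γ _)
  rw [Metric.tendsto_nhds]
  intro ε hε
  -- The tail of the difference costs at most `2 (ε/8 + ε/8)`, which leaves `ε/2` for the finitely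
  -- many modes in `A`.
  obtain ⟨A, hA⟩ := htail (ε / 8) (by positivity)
  have h1 : Tendsto (fun s => ∑ k ∈ A, sobWeight γ k * ‖v s k - v t k‖ ^ 2) (𝓝[S] t) (𝓝 0) := by
    rw [← Finset.sum_const_zero (s := A)]
    refine tendsto_finsetSum _ fun k _ => ?_
    have : Tendsto (fun s => ‖v s k - v t k‖) (𝓝[S] t) (𝓝 0) :=
      tendsto_iff_norm_sub_tendsto_zero.1 (hc k)
    simpa using (this.pow 2).const_mul (sobWeight γ k)
  filter_upwards [h1 (Iio_mem_nhds (half_pos hε)), self_mem_nhdsWithin] with s hs hsS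
  rw [Real.dist_eq, sub_zero, abs_of_nonneg (hnn s)]
  refine lt_of_le_of_lt (Real.tsum_le_of_sum_le (sobTerm_nonneg γ _) fun B => ?_)
    (add_lt_of_lt_sub_right (by rw [mem_preimage, mem_Iio] at hs; linarith :
      (∑ k ∈ A, sobWeight γ k * ‖v s k - v t k‖ ^ 2) < ε - ε / 2))
  classical
  rw [← Finset.sum_inter_add_sum_sdiff B A]
  refine add_le_add ?_ ?_
  · exact Finset.sum_le_sum_of_subset_of_nonneg Finset.inter_subset_right fun k _ _ =>
      sobTerm_nonneg γ (fun k => v s k - v t k) k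
  · calc ∑ k ∈ B \ A, sobWeight γ k * ‖v s k - v t k‖ ^ 2
        ≤ ∑ k ∈ B \ A, 2 * (sobWeight γ k * ‖v s k‖ ^ 2 + sobWeight γ k * ‖v t k‖ ^ 2) := by
          refine Finset.sum_le_sum fun k _ => ?_
          nlinarith [mul_le_mul_of_nonneg_left (norm_sub_sq_le (v s k) (v t k))
            (sobWeight_pos γ k).le]
      _ ≤ 2 * (ε / 8 + ε / 8) := by
          rw [← Finset.mul_sum, Finset.sum_add_distrib]
          have := hA s hsS (B \ A) Finset.sdiff_disjoint
          have := hA t ht (B \ A) Finset.sdiff_disjoint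
          linarith
      _ = ε / 2 := by ring

theorem summable_inv_sobWeight {γ : ℝ} (hγ : 2 + (d : ℝ) / 2 ≤ γ) :
    Summable fun k : Fin d → ℤ => (sobWeight γ k)⁻¹ := by
  have h1 : Summable fun k : Fin d → ℤ => if k = 0 then (1 : ℝ) else 0 :=
    summable_of_ne_finset_zero (s := {0}) fun k hk => by simpa using hk
  refine Summable.of_nonneg_of_le (fun k => (inv_pos.2 (sobWeight_pos γ k)).le) (fun k => ?_)
    ((summable_freqNorm_sq_div hγ).add h1)
  rcases eq_or_ne k 0 with rfl | hk
  · simp [freqNorm_zero, sobWeight]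
  · have h2 := one_le_freqNorm hk
    have h3 := sobWeight_pos γ k
    rw [if_neg hk, add_zero, div_eq_mul_inv]
    exact le_mul_of_one_le_left (by positivity) (one_le_pow₀ h2)

/-! ### Local existence -/

/-- The frequencies in a box, without the origin. -/
noncomputable def box (d N : ℕ) : Finset (Fin d → ℤ) :=
  (Finset.Icc (fun _ => -(N : ℤ)) fun _ => (N : ℤ)).erase 0

theorem zero_notMem_box (d N : ℕ) : 0 ∉ box d N := by simp [box]

theorem neg_mem_box {N : ℕ} {k : Fin d → ℤ} (hk : k ∈ box d N) : -k ∈ box d N := by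
  simp only [box, Finset.mem_erase, Finset.mem_Icc, Pi.le_def] at hk ⊢
  refine ⟨neg_ne_zero.2 hk.1, fun i => ?_, fun i => ?_⟩
  · have := hk.2.2 i
    simp only [Pi.neg_apply]
    omega
  · have := hk.2.1 i
    simp only [Pi.neg_apply]
    omega

theorem abs_le_freqNorm (k : Fin d → ℤ) (i : Fin d) : |(k i : ℝ)| ≤ freqNorm k := by
  rw [freqNorm_eq_norm]
  exact PiLp.norm_apply_le (WithLp.toLp 2 fun i => (k i : ℝ) : EuclideanSpace ℝ (Fin d)) i

theorem mem_box_of_freqNorm_le {N : ℕ} {k : Fin d → ℤ} (hk : k ≠ 0) (h : freqNorm k ≤ N) :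
    k ∈ box d N := by
  have h1 : ∀ i, |k i| ≤ N := fun i => by
    have := (abs_le_freqNorm k i).trans h
    exact_mod_cast this
  simp only [box, Finset.mem_erase, Finset.mem_Icc, Pi.le_def]
  exact ⟨hk, fun i => (abs_le.1 (h1 i)).1, fun i => (abs_le.1 (h1 i)).2⟩

/-- The restriction of a field to the frequencies in `F`. -/
noncomputable def truncate (F : Finset (Fin d → ℤ)) (v : Field d) : Field d :=
  fun k => if k ∈ F then v k else 0

theorem isTrigPoly_truncate {F : Finset (Fin d → ℤ)} (hF : 0 ∉ F) (hFs : ∀ k ∈ F, -k ∈ F) {γ : ℝ}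
    {v : Field d} (hv : MemV γ v) : IsTrigPoly F (truncate F v) := by
  refine ⟨fun k hk => if_neg hk, fun k => ?_, fun k => ?_, if_neg hF⟩
  · by_cases hk : k ∈ F
    · rw [truncate, truncate, if_pos hk, if_pos (hFs k hk), hv.real]
    · rw [truncate, truncate, if_neg hk, if_neg fun h => hk (by simpa using hFs _ h), conjVec_zero]
  · by_cases hk : k ∈ F
    · rw [truncate, if_pos hk, hv.divFree]
    · simp [truncate, hk, dotFreq]

theorem energy_truncate (F : Finset (Fin d → ℤ)) (W : (Fin d → ℤ) → ℝ) (v : Field d) :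
    energy F W (truncate F v) = energy F W v :=
  Finset.sum_congr rfl fun k hk => by rw [truncate, if_pos hk]

theorem IsTrigPoly.sum_le_energy {F : Finset (Fin d → ℤ)} {v : Field d} (hv : IsTrigPoly F v)
    {W : (Fin d → ℤ) → ℝ} (hW : ∀ k, 0 ≤ W k) (B : Finset (Fin d → ℤ)) :
    ∑ k ∈ B, W k * ‖v k‖ ^ 2 ≤ energy F W v := by
  have h0 : ∀ k, k ∉ F → W k * ‖v k‖ ^ 2 = 0 := fun k hk => by rw [hv.supp k hk]; simp
  have h1 : ∑' k, W k * ‖v k‖ ^ 2 = energy F W v := tsum_eq_sum fun k hk => h0 k hk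
  rw [← h1]
  exact (summable_of_ne_finset_zero (s := F) h0).sum_le_tsum _
    fun k _ => mul_nonneg (hW k) (sq_nonneg _)

/-- The weight of `H^γ` multiplied by a factor that is small below the frequency `R`. -/
noncomputable def tailWeight (γ R : ℝ) (k : Fin d → ℤ) : ℝ :=
  sobWeight γ k * min 1 (freqNorm k / R)

theorem tailWeight_nonneg (γ : ℝ) {R : ℝ} (hR : 0 < R) (k : Fin d → ℤ) : 0 ≤ tailWeight γ R k :=
  mul_nonneg (sobWeight_pos γ k).le (le_min zero_le_one (div_nonneg (freqNorm_nonneg k) hR.le))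

theorem tailWeight_le (γ R : ℝ) (k : Fin d → ℤ) : tailWeight γ R k ≤ sobWeight γ k :=
  mul_le_of_le_one_right (sobWeight_pos γ k).le (min_le_left _ _)

theorem tendsto_tsum_tailWeight {γ : ℝ} {v : Field d} (hv : MemH γ v) :
    Tendsto (fun R : ℝ => ∑' k, tailWeight γ R k * ‖v k‖ ^ 2) atTop (𝓝 0) := by
  have h0 : ∑' _ : Fin d → ℤ, (0 : ℝ) = 0 := tsum_zero
  rw [← h0]
  refine tendsto_tsum_of_dominated_convergence hv (fun k => ?_) ?_
  · have h1 : Tendsto (fun R : ℝ => freqNorm k / R) atTop (𝓝 0) :=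
      tendsto_const_nhds.div_atTop tendsto_id
    have h2 := (((tendsto_const_nhds (x := (1 : ℝ))).min h1).const_mul
      (sobWeight γ k)).mul_const (‖v k‖ ^ 2)
    simpa [tailWeight] using h2
  · filter_upwards [eventually_gt_atTop 0] with R hR k
    rw [Real.norm_of_nonneg (mul_nonneg (tailWeight_nonneg γ hR k) (sq_nonneg _))]
    exact mul_le_mul_of_nonneg_right (tailWeight_le γ R k) (sq_nonneg _)

/-- Local existence in `H^γ`, on a time interval that depends only on the norm of the initial
value. -/
theorem exists_isSolutionOn {c : ℝ} {m₁ m₂ : (Fin d → ℤ) → ℝ} (hs : IsSymbolPair c m₁ m₂) {γ : ℝ}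
    (hγ : 2 + (d : ℝ) / 2 ≤ γ) {v₀ : Field d} (hv₀ : MemV γ v₀) {Q : ℝ} (hQ : sobNormSq γ v₀ ≤ Q)
    {τ : ℝ} (hτ0 : 0 ≤ τ) (hτ : energyConst d ⌈2 * γ⌉₊ γ c * τ ≤ (√(Q + 1))⁻¹) :
    ∃ w : ℝ → Field d, w 0 = v₀ ∧ IsSolutionOn γ m₁ m₂ (Icc 0 τ) w := by
  have hγ0 : 0 ≤ γ := by
    have : (0 : ℝ) ≤ d := Nat.cast_nonneg d
    linarith
  have hW0 := isWeight_sobWeight (d := d) hγ0 (Nat.le_ceil (2 * γ))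
  have hinit : ∀ N, energy (box d N) (sobWeight γ) (truncate (box d N) v₀) ≤ Q := fun N => by
    rw [energy_truncate]
    exact (hv₀.memH.sum_le_tsum _ fun k _ => sobTerm_nonneg γ v₀ k).trans hQ
  choose u hu0 hu using fun N => exists_isGalerkinPath hs (zero_notMem_box d N)
    (fun k => neg_mem_box) (isTrigPoly_truncate (zero_notMem_box d N) (fun k => neg_mem_box) hv₀)
    hγ (hinit N) hτ0 hτ
  have hinit' : ∀ N, energy (box d N) (sobWeight γ) (u N 0) ≤ Q := fun N => by
    rw [hu0]; exact hinit N
  have henergy : ∀ N, ∀ t ∈ Icc 0 τ, ∀ B : Finset (Fin d → ℤ),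
      ∑ k ∈ B, sobWeight γ k * ‖u N t k‖ ^ 2 ≤ 4 * (Q + 1) := fun N t ht B =>
    (((hu N).trigPoly t ht).sum_le_energy hW0.nonneg B).trans
      ((hu N).energy_le hs (zero_notMem_box d N) hγ (hinit' N) hτ ht)
  -- The Grönwall factor for all the weights `tailWeight γ R`; neither `R` nor `N` enters.
  set C : ℝ := Real.exp (energyConst d (⌈2 * γ⌉₊ + 1) γ c * √(4 * (Q + 1)) * τ)
  have htail : ∀ R : ℝ, 0 < R → ∀ N, ∀ t ∈ Icc 0 τ, ∀ B : Finset (Fin d → ℤ),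
      ∑ k ∈ B, tailWeight γ R k * ‖u N t k‖ ^ 2 ≤ C * ∑' k, tailWeight γ R k * ‖v₀ k‖ ^ 2 := by
    intro R hR N t ht B
    have h1 := (hu N).weighted_energy_le hs (zero_notMem_box d N) hγ (hinit' N) hτ
      (hW0.mul_min hR) ht
    refine (((hu N).trigPoly t ht).sum_le_energy (tailWeight_nonneg γ hR) B).trans (h1.trans ?_)
    refine mul_le_mul_of_nonneg_left ?_ (Real.exp_pos _).le
    rw [hu0, energy_truncate]
    have h2 : ∀ k, 0 ≤ tailWeight γ R k * ‖v₀ k‖ ^ 2 := fun k =>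
      mul_nonneg (tailWeight_nonneg γ hR k) (sq_nonneg _)
    exact (Summable.of_nonneg_of_le h2 (fun k => mul_le_mul_of_nonneg_right (tailWeight_le γ R k)
      (sq_nonneg _)) hv₀.memH).sum_le_tsum _ fun k _ => h2 k
  set b : (Fin d → ℤ) → ℝ := fun k => √(4 * (Q + 1) * (sobWeight γ k)⁻¹)
  have hQ0 : 0 ≤ Q := (tsum_nonneg (sobTerm_nonneg γ v₀)).trans hQ
  have hb : Summable fun k => b k ^ 2 := by
    refine ((summable_inv_sobWeight hγ).mul_left (4 * (Q + 1))).congr fun k => ?_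
    rw [Real.sq_sqrt]
    have := (sobWeight_pos γ k).le
    positivity
  have hub : ∀ N, ∀ t ∈ Icc 0 τ, u N t 0 = 0 ∧ ∀ k, ‖u N t k‖ ≤ b k := by
    refine fun N t ht => ⟨((hu N).trigPoly t ht).meanZero, fun k => Real.le_sqrt_of_sq_le ?_⟩
    have h1 := henergy N t ht {k}
    rw [Finset.sum_singleton] at h1
    rw [← div_eq_mul_inv, le_div_iff₀ (sobWeight_pos γ k)]
    linarith
  choose L hL0 hL using norm_vectorField_le hs hb
  have hderiv : ∀ N k, k ∈ box d N → ∀ t ∈ Icc 0 τ,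
      HasDerivWithinAt (fun s => u N s k) (vectorField m₁ m₂ (u N t) k) (Icc 0 τ) t := by
    intro N k hk t ht
    simpa only [one_smul] using (hu N).deriv t ht k hk
  have hlip : ∀ N k, ∀ s ∈ Icc 0 τ, ∀ t ∈ Icc 0 τ, ‖u N s k - u N t k‖ ≤ L k * ‖s - t‖ := by
    intro N k s hsm t ht
    by_cases hk : k ∈ box d N
    · exact (convex_Icc 0 τ).norm_image_sub_le_of_norm_hasDerivWithin_le (hderiv N k hk)
        (fun r hr => hL k _ (hub N r hr).1 (hub N r hr).2) ht hsm
    · rw [((hu N).trigPoly s hsm).supp k hk, ((hu N).trigPoly t ht).supp k hk, sub_zero, norm_zero]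
      exact mul_nonneg (hL0 k) (norm_nonneg _)
  -- Along a non-principal ultrafilter the bounded coefficients converge for all `t` and `k` at
  -- once, with no extraction of subsequences.
  let U : Filter ℕ := (hyperfilter ℕ : Filter ℕ)
  have hlim : ∀ t k, ∃ x, t ∈ Icc 0 τ → Tendsto (fun N => u N t k) U (𝓝 x) := by
    intro t k
    by_cases ht : t ∈ Icc 0 τ
    · have h1 := isCompact_iff_ultrafilter_le_nhds.1
        (isCompact_closedBall (0 : EuclideanSpace ℂ (Fin d)) (b k))
        ((hyperfilter ℕ).map fun N => u N t k) (by
          rw [Ultrafilter.coe_map, le_principal_iff, mem_map]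
          exact Eventually.of_forall fun N => mem_closedBall_zero_iff.2 ((hub N t ht).2 k))
      obtain ⟨x, -, hx⟩ := h1
      exact ⟨x, fun _ => hx⟩
    · exact ⟨0, fun h => absurd h ht⟩
  choose w hw using hlim
  have hUbox : ∀ k : Fin d → ℤ, k ≠ 0 → ∀ᶠ N in U, k ∈ box d N := by
    intro k hk
    have h1 : ∀ᶠ N : ℕ in atTop, k ∈ box d N := by
      filter_upwards [eventually_ge_atTop ⌈freqNorm k⌉₊] with N hN
      exact mem_box_of_freqNorm_le hk (Nat.ceil_le.1 hN)
    exact Nat.hyperfilter_le_atTop h1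
  have hsum_le : ∀ (W : (Fin d → ℤ) → ℝ) (D : ℝ), ∀ t ∈ Icc 0 τ, ∀ B : Finset (Fin d → ℤ),
      (∀ N, ∑ k ∈ B, W k * ‖u N t k‖ ^ 2 ≤ D) → ∑ k ∈ B, W k * ‖w t k‖ ^ 2 ≤ D := by
    intro W D t ht B h
    exact le_of_tendsto (tendsto_finsetSum _ fun k _ => ((hw t k ht).norm.pow 2).const_mul (W k))
      (Eventually.of_forall h)
  have hw0 : w 0 = v₀ := by
    have h0 : (0 : ℝ) ∈ Icc 0 τ := left_mem_Icc.2 hτ0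
    ext1 k
    refine tendsto_nhds_unique (hw 0 k h0) ?_
    rcases eq_or_ne k 0 with rfl | hk
    · simp only [(hub _ 0 h0).1, hv₀.meanZero]
      exact tendsto_const_nhds
    · refine tendsto_const_nhds.congr' ?_
      filter_upwards [hUbox k hk] with N hN
      rw [hu0, truncate, if_pos hN]
  have hmem : ∀ t ∈ Icc 0 τ, MemV γ (w t) := by
    intro t ht
    refine ⟨summable_of_sum_le (sobTerm_nonneg γ _) fun B =>
      hsum_le _ _ t ht B fun N => henergy N t ht B, fun k => ?_, fun k => ?_, ?_⟩
    · refine tendsto_nhds_unique (hw t (-k) ht) ?_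
      simp only [((hu _).trigPoly t ht).real k]
      exact (continuous_conjVec.tendsto _).comp (hw t k ht)
    · refine tendsto_nhds_unique (f := fun N => dotFreq (u N t k) k) (l := U) ?_ ?_
      · simp only [← dotFreqL_apply]
        exact ((dotFreqL k).continuous.tendsto _).comp (hw t k ht)
      · simp only [((hu _).trigPoly t ht).divFree k]
        exact tendsto_const_nhds
    · refine tendsto_nhds_unique (hw t 0 ht) ?_
      simp only [(hub _ t ht).1]
      exact tendsto_const_nhds
  -- The Lipschitz constants `L k` do not depend on `N`, which upgrades pointwise convergence to
  -- joint convergence in `N` and time.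
  have hjoint : ∀ t ∈ Icc 0 τ, ∀ k,
      Tendsto (fun p : ℕ × ℝ => u p.1 p.2 k) (U ×ˢ 𝓝[Icc 0 τ] t) (𝓝 (w t k)) := by
    intro t ht k
    rw [tendsto_iff_norm_sub_tendsto_zero]
    have h1 : Tendsto (fun p : ℕ × ℝ => L k * ‖p.2 - t‖) (U ×ˢ 𝓝[Icc 0 τ] t) (𝓝 0) := by
      have : Tendsto (fun s : ℝ => L k * ‖s - t‖) (𝓝[Icc 0 τ] t) (𝓝 (L k * ‖t - t‖)) :=
        (Continuous.tendsto (by fun_prop) t).mono_left nhdsWithin_le_nhds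
      rw [sub_self, norm_zero, mul_zero] at this
      exact this.comp tendsto_snd
    have h2 : Tendsto (fun p : ℕ × ℝ => ‖u p.1 t k - w t k‖) (U ×ˢ 𝓝[Icc 0 τ] t) (𝓝 0) :=
      (tendsto_iff_norm_sub_tendsto_zero.1 (hw t k ht)).comp tendsto_fst
    have h3 := h1.add h2
    rw [add_zero] at h3
    refine squeeze_zero' (Eventually.of_forall fun _ => norm_nonneg _) ?_ h3
    filter_upwards [tendsto_snd.eventually (self_mem_nhdsWithin (a := t) (s := Icc 0 τ))] with p hp
    exact (norm_sub_le_norm_sub_add_norm_sub _ (u p.1 t k) _).trans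
      (add_le_add (hlip p.1 k p.2 hp t ht) le_rfl)
  have heq : ∀ t ∈ Icc 0 τ, ∀ k, k ≠ 0 →
      HasDerivWithinAt (fun s => w s k) (vectorField m₁ m₂ (w t) k) (Icc 0 τ) t := by
    intro t ht k hk
    refine hasDerivWithinAt_of_tendsto (l := U) (f := fun N s => u N s k)
      (f' := fun N s => vectorField m₁ m₂ (u N s) k) (convex_Icc 0 τ) ht ?_ ?_
      fun s hs => hw s k hs
    · filter_upwards [hUbox k hk] with N hN
      exact hderiv N k hN
    · refine tendsto_vectorField hs (x := fun p : ℕ × ℝ => u p.1 p.2) (hjoint t ht) hb ?_ k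
      filter_upwards [tendsto_snd.eventually (self_mem_nhdsWithin (a := t) (s := Icc 0 τ))]
        with p hp
      exact hub p.1 p.2 hp
  have hcont : ∀ t ∈ Icc 0 τ, ∀ k, ContinuousWithinAt (fun s => w s k) (Icc 0 τ) t := by
    intro t ht k
    rcases eq_or_ne k 0 with rfl | hk
    · refine continuousWithinAt_const.congr (fun s hs => (hmem s hs).meanZero) (hmem t ht).meanZero
    · exact (heq t ht k hk).continuousWithinAt
  have hstrong : ∀ t ∈ Icc 0 τ,
      Tendsto (fun s => sobNormSq γ fun k => w s k - w t k) (𝓝[Icc 0 τ] t) (𝓝 0) := by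
    intro t ht
    refine tendsto_sobNormSq ht (hcont t ht) fun ε hε => ?_
    have h1 : Tendsto (fun R : ℝ => C * ∑' k, tailWeight γ R k * ‖v₀ k‖ ^ 2) atTop (𝓝 0) := by
      simpa using (tendsto_tsum_tailWeight hv₀.memH).const_mul C
    obtain ⟨R, hR, hR0⟩ := ((h1.eventually (Iio_mem_nhds hε)).and (eventually_gt_atTop 0)).exists
    -- Outside this set `|k| ≥ R`, where `tailWeight` is the Sobolev weight. The origin is added
    -- because the boxes omit it.
    refine ⟨insert 0 (box d ⌈R⌉₊), fun s hsm B hB => ?_⟩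
    have h2 := hsum_le _ _ s hsm B fun N => htail R hR0 N s hsm B
    refine le_trans (Finset.sum_le_sum fun k hk => ?_) (h2.trans hR.le)
    have hk' : k ∉ insert 0 (box d ⌈R⌉₊) := Finset.disjoint_left.1 hB hk
    rw [Finset.mem_insert, not_or] at hk'
    have h3 : R ≤ freqNorm k := by
      by_contra! h
      exact hk'.2 (mem_box_of_freqNorm_le hk'.1 (h.le.trans (Nat.le_ceil R)))
    rw [tailWeight, min_eq_left ((one_le_div hR0).2 h3), mul_one]
  refine ⟨w, hw0, hmem, heq, fun y hy => continuousOn_sobInner (fun t ht => (hmem t ht).memH)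
    hstrong hy.memH, fun t ht => ?_⟩
  exact (hstrong t ht).mono_left (nhdsWithin_mono t inter_subset_left)

/-! ### Restriction, translation and gluing of solutions -/

theorem IsSolutionOn.mono {γ : ℝ} {m₁ m₂ : (Fin d → ℤ) → ℝ} {S S' : Set ℝ} {v : ℝ → Field d}
    (hv : IsSolutionOn γ m₁ m₂ S v) (h : S' ⊆ S) : IsSolutionOn γ m₁ m₂ S' v where
  memV t ht := hv.memV t (h ht)
  equation t ht k hk := (hv.equation t (h ht) k hk).mono h
  weakCont w hw := (hv.weakCont w hw).mono h
  rightCont t ht := (hv.rightCont t (h ht)).mono_left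
    (nhdsWithin_mono t (inter_subset_inter_left _ h))

theorem IsSolutionOn.congr {γ : ℝ} {m₁ m₂ : (Fin d → ℤ) → ℝ} {S : Set ℝ} {v w : ℝ → Field d}
    (hv : IsSolutionOn γ m₁ m₂ S v) (h : ∀ t ∈ S, w t = v t) : IsSolutionOn γ m₁ m₂ S w where
  memV t ht := by rw [h t ht]; exact hv.memV t ht
  equation t ht k hk := by
    rw [h t ht]
    exact (hv.equation t ht k hk).congr (fun s hs => by rw [h s hs]) (by rw [h t ht])
  weakCont y hy := (hv.weakCont y hy).congr fun t ht => by rw [h t ht]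
  rightCont t ht := by
    refine (hv.rightCont t ht).congr' ?_
    filter_upwards [self_mem_nhdsWithin] with s hs
    rw [h t ht, h s hs.1]

theorem IsSolutionOn.shift {γ : ℝ} {m₁ m₂ : (Fin d → ℤ) → ℝ} {τ : ℝ} {w : ℝ → Field d}
    (hw : IsSolutionOn γ m₁ m₂ (Icc 0 τ) w) (a : ℝ) :
    IsSolutionOn γ m₁ m₂ (Icc a (a + τ)) fun t => w (t - a) := by
  have hmaps : ∀ t ∈ Icc a (a + τ), t - a ∈ Icc 0 τ := fun t ht =>
    ⟨by linarith [ht.1], by linarith [ht.2]⟩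
  have hc : Continuous fun t : ℝ => t - a := by fun_prop
  refine ⟨fun t ht => hw.memV _ (hmaps t ht), fun t ht k hk => ?_, fun y hy => ?_, fun t ht => ?_⟩
  · have h1 := (hw.equation _ (hmaps t ht) k hk).scomp t
      ((hasDerivWithinAt_id t (Icc a (a + τ))).sub_const a) hmaps
    rwa [one_smul] at h1
  · exact (hw.weakCont y hy).comp hc.continuousOn hmaps
  · refine (hw.rightCont _ (hmaps t ht)).comp
      (tendsto_nhdsWithin_of_tendsto_nhds_of_eventually_within _
        ((hc.tendsto t).mono_left nhdsWithin_le_nhds) ?_)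
    filter_upwards [self_mem_nhdsWithin] with s hs
    exact ⟨hmaps s hs.1, sub_lt_sub_right hs.2 a⟩

/-- Closedness makes the local conditions relative to `A` vacuous at points off `A`, and likewise
for `B`; at common points both pieces have the same derivative, given by the equation. -/
theorem IsSolutionOn.union {γ : ℝ} {m₁ m₂ : (Fin d → ℤ) → ℝ} {A B : Set ℝ} (hA : IsClosed A)
    (hB : IsClosed B) {v : ℝ → Field d} (hvA : IsSolutionOn γ m₁ m₂ A v)
    (hvB : IsSolutionOn γ m₁ m₂ B v) : IsSolutionOn γ m₁ m₂ (A ∪ B) v where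
  memV t ht := ht.elim (hvA.memV t) (hvB.memV t)
  equation t _ k hk := by
    have key : ∀ C : Set ℝ, IsClosed C → IsSolutionOn γ m₁ m₂ C v →
        HasDerivWithinAt (fun s => v s k) (vectorField m₁ m₂ (v t) k) C t := by
      intro C hC hv
      by_cases ht : t ∈ C
      · exact hv.equation t ht k hk
      · exact HasFDerivWithinAt.of_notMem_closure (by rwa [hC.closure_eq])
    exact (key A hA hvA).union (key B hB hvB)
  weakCont y hy := (hvA.weakCont y hy).union_of_isClosed (hvB.weakCont y hy) hA hB
  rightCont t _ := by
    have key : ∀ C : Set ℝ, IsClosed C → IsSolutionOn γ m₁ m₂ C v →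
        Tendsto (fun s => sobNormSq γ (fun k => v s k - v t k)) (𝓝[C ∩ Ioi t] t) (𝓝 0) := by
      intro C hC hv
      by_cases ht : t ∈ C
      · exact hv.rightCont t ht
      · have h1 : 𝓝[C] t = ⊥ := by
          rwa [← notMem_closure_iff_nhdsWithin_eq_bot, hC.closure_eq]
        rw [nhdsWithin_inter, h1, bot_inf_eq]
        exact tendsto_bot
    rw [union_inter_distrib_right, nhdsWithin_union]
    exact (key A hA hvA).sup (key B hB hvB)

theorem IsSolutionOn.exists_extension {γ : ℝ} {m₁ m₂ : (Fin d → ℤ) → ℝ} {a τ : ℝ} (ha : 0 ≤ a)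
    (hτ : 0 ≤ τ) {v w : ℝ → Field d} (hv : IsSolutionOn γ m₁ m₂ (Icc 0 a) v)
    (hw : IsSolutionOn γ m₁ m₂ (Icc 0 τ) w) (h : w 0 = v a) :
    ∃ z : ℝ → Field d, z 0 = v 0 ∧ IsSolutionOn γ m₁ m₂ (Icc 0 (a + τ)) z := by
  refine ⟨fun t => if t ≤ a then v t else w (t - a), if_pos ha, ?_⟩
  rw [← Icc_union_Icc_eq_Icc ha (by linarith : a ≤ a + τ)]
  refine IsSolutionOn.union isClosed_Icc isClosed_Icc (hv.congr fun t ht => if_pos ht.2)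
    ((hw.shift a).congr fun t ht => ?_)
  rcases ht.1.eq_or_lt with rfl | h1
  · simp [h]
  · exact if_neg h1.not_ge

/-! ### The shell approximation and the Sobolev norm -/

theorem IsCutoff.anti {Φ : ℝ → ℝ} (hΦ : IsCutoff Φ) {x y : ℝ} (hx : 0 ≤ x) (hxy : x ≤ y) :
    Φ y ≤ Φ x := by
  rcases le_total x 1 with h1 | h1
  · rw [hΦ.eq_one x hx h1]
    exact (hΦ.mapsTo y (hx.trans hxy)).2
  rcases le_total 2 y with h2 | h2
  · rw [hΦ.eq_zero y h2]
    exact (hΦ.mapsTo x hx).1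
  · exact hΦ.strictAnti.antitoneOn ⟨h1, hxy.trans h2⟩ ⟨h1.trans hxy, h2⟩ hxy

theorem freqNorm_div_nonneg (k : Fin d → ℤ) (n : ℕ) : 0 ≤ freqNorm k / 2 ^ n :=
  div_nonneg (freqNorm_nonneg k) (by positivity)

theorem IsCutoff.shellBump_nonneg {Φ : ℝ → ℝ} (hΦ : IsCutoff Φ) (n : ℕ) (k : Fin d → ℤ) :
    0 ≤ shellBump Φ n k :=
  sub_nonneg.2 (hΦ.anti (freqNorm_div_nonneg k n) (by linarith [freqNorm_div_nonneg k n]))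

theorem IsCutoff.shellBump_le_one {Φ : ℝ → ℝ} (hΦ : IsCutoff Φ) (n : ℕ) (k : Fin d → ℤ) :
    shellBump Φ n k ≤ 1 := by
  have h1 := (hΦ.mapsTo _ (freqNorm_div_nonneg k n)).2
  have h2 := (hΦ.mapsTo (2 * (freqNorm k / 2 ^ n)) (by linarith [freqNorm_div_nonneg k n])).1
  unfold shellBump
  linarith

/-- The sum telescopes to `Φ(2|k|/2^N) - Φ(2|k|)`. The second term vanishes since `|k| ≥ 1`, so
shells with `n ≥ 0` suffice. -/
theorem IsCutoff.sum_shellBump {Φ : ℝ → ℝ} (hΦ : IsCutoff Φ) {k : Fin d → ℤ} (hk : k ≠ 0) {N : ℕ}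
    (hN : 2 * freqNorm k ≤ 2 ^ N) : ∑ n ∈ Finset.range N, shellBump Φ n k = 1 := by
  have h1 := one_le_freqNorm hk
  have h2 : ∀ n, shellBump Φ n k =
      Φ (2 * freqNorm k / 2 ^ (n + 1)) - Φ (2 * freqNorm k / 2 ^ n) := by
    intro n
    rw [shellBump, pow_succ']
    congr 2
    · rw [mul_div_mul_left _ _ two_ne_zero]
    · rw [mul_div_assoc]
  simp only [h2]
  rw [Finset.sum_range_sub (fun n => Φ (2 * freqNorm k / 2 ^ n)), pow_zero, div_one,
    hΦ.eq_zero (2 * freqNorm k) (by linarith), sub_zero]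
  exact hΦ.eq_one _ (by positivity) ((div_le_one (by positivity)).2 hN)

/-- Where the bump is nonzero, `|k| ≤ 2^(n+1)`, hence `1 + |k|² ≤ 5 · 4^n ≤ 8 · 4^n`. -/
theorem IsCutoff.sobWeight_mul_shellBump_le {Φ : ℝ → ℝ} (hΦ : IsCutoff Φ) {γ : ℝ} (hγ : 0 ≤ γ)
    {k : Fin d → ℤ} (hk : k ≠ 0) (n : ℕ) :
    sobWeight γ k * shellBump Φ n k ≤ 8 ^ γ * (2 ^ (2 * γ * n) * shellBump Φ n k) := by
  have h1 := one_le_freqNorm hk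
  rcases le_total 2 (freqNorm k / 2 ^ n) with h2 | h2
  · have : shellBump Φ n k = 0 := by
      rw [shellBump, hΦ.eq_zero _ h2, hΦ.eq_zero _ (by linarith), sub_zero]
    simp [this]
  · rw [← mul_assoc]
    refine mul_le_mul_of_nonneg_right ?_ (hΦ.shellBump_nonneg n k)
    rw [div_le_iff₀ (by positivity)] at h2
    have h3 : (1 : ℝ) ≤ 2 ^ n := one_le_pow₀ (by norm_num)
    calc sobWeight γ k ≤ (8 * (2 ^ n) ^ 2) ^ γ := by
          unfold sobWeight
          refine Real.rpow_le_rpow (by positivity) ?_ hγ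
          nlinarith
      _ = 8 ^ γ * 2 ^ (2 * γ * n) := by
          rw [Real.mul_rpow (by positivity) (by positivity), ← pow_mul, ← Real.rpow_natCast,
            ← Real.rpow_mul (by positivity)]
          congr 2
          push_cast
          ring

theorem IsCutoff.sobWeight_le_sum {Φ : ℝ → ℝ} (hΦ : IsCutoff Φ) {γ : ℝ} (hγ : 0 ≤ γ)
    {k : Fin d → ℤ} (hk : k ≠ 0) {N : ℕ} (hN : 2 * freqNorm k ≤ 2 ^ N) :
    sobWeight γ k ≤ 8 ^ γ * ∑ n ∈ Finset.range N, 2 ^ (2 * γ * n) * shellBump Φ n k := by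
  calc sobWeight γ k = ∑ n ∈ Finset.range N, sobWeight γ k * shellBump Φ n k := by
        rw [← Finset.mul_sum, hΦ.sum_shellBump hk hN, mul_one]
    _ ≤ _ := by
        rw [Finset.mul_sum]
        exact Finset.sum_le_sum fun n _ => hΦ.sobWeight_mul_shellBump_le hγ hk n

theorem IsCutoff.sobNormSq_le {Φ : ℝ → ℝ} (hΦ : IsCutoff Φ) {γ : ℝ} (hγ : 0 ≤ γ)
    {v : ℝ → Field d} {t : ℝ} (hv : MemV γ (v t)) {M : ℝ≥0∞} (hM : M ≠ ⊤)
    (h : ∑' n : ℕ, ENNReal.ofReal ((2 : ℝ) ^ (2 * γ * (n : ℝ)) * shellApprox Φ v n t ^ 2) ≤ M) :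
    sobNormSq γ (v t) ≤ 8 ^ γ * M.toReal := by
  have hψ : ∀ n k, 0 ≤ shellBump Φ n k * ‖v t k‖ ^ 2 := fun n k =>
    mul_nonneg (hΦ.shellBump_nonneg n k) (sq_nonneg _)
  have hsummable : ∀ n, Summable fun k => shellBump Φ n k * ‖v t k‖ ^ 2 := fun n =>
    Summable.of_nonneg_of_le (hψ n) (fun k => mul_le_mul_of_nonneg_right
      ((hΦ.shellBump_le_one n k).trans (one_le_sobWeight hγ k)) (sq_nonneg _)) hv.memH
  have hX : ∀ n, shellApprox Φ v n t ^ 2 = ∑' k, shellBump Φ n k * ‖v t k‖ ^ 2 := fun n =>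
    Real.sq_sqrt (tsum_nonneg (hψ n))
  have hfin : ∀ N : ℕ, ∑ n ∈ Finset.range N,
      (2 : ℝ) ^ (2 * γ * (n : ℝ)) * shellApprox Φ v n t ^ 2 ≤ M.toReal := by
    intro N
    rw [← ENNReal.ofReal_le_iff_le_toReal hM, ENNReal.ofReal_sum_of_nonneg fun n _ => by positivity]
    exact (ENNReal.sum_le_tsum _).trans h
  refine Real.tsum_le_of_sum_le (sobTerm_nonneg γ _) fun B => ?_
  obtain ⟨r, hr⟩ := (B.image fun k => 2 * freqNorm k).exists_le
  obtain ⟨N, hN⟩ := pow_unbounded_of_one_lt r (one_lt_two (α := ℝ))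
  have hBN : ∀ k ∈ B, 2 * freqNorm k ≤ 2 ^ N := fun k hk =>
    (hr _ (Finset.mem_image_of_mem _ hk)).trans hN.le
  calc ∑ k ∈ B, sobWeight γ k * ‖v t k‖ ^ 2
      ≤ ∑ k ∈ B, (8 ^ γ * ∑ n ∈ Finset.range N, 2 ^ (2 * γ * n) * shellBump Φ n k) *
          ‖v t k‖ ^ 2 := by
        refine Finset.sum_le_sum fun k hk => ?_
        rcases eq_or_ne k 0 with rfl | hk0
        · simp [hv.meanZero]
        · exact mul_le_mul_of_nonneg_right (hΦ.sobWeight_le_sum hγ hk0 (hBN k hk)) (sq_nonneg _)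
    _ = 8 ^ γ * ∑ n ∈ Finset.range N,
          (2 : ℝ) ^ (2 * γ * (n : ℝ)) * ∑ k ∈ B, shellBump Φ n k * ‖v t k‖ ^ 2 := by
        simp only [mul_assoc, ← Finset.mul_sum, Finset.sum_mul]
        rw [Finset.sum_comm]
        simp only [← Finset.mul_sum]
    _ ≤ 8 ^ γ * ∑ n ∈ Finset.range N, (2 : ℝ) ^ (2 * γ * (n : ℝ)) * shellApprox Φ v n t ^ 2 := by
        gcongr with n hn
        rw [hX]
        exact (hsummable n).sum_le_tsum _ fun k _ => hψ n k
    _ ≤ _ := by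
        gcongr
        exact hfin N

/-! ### Continuation -/

theorem isSymbolPair_of_le {α β : ℝ} (hβ : 0 ≤ β) {g : ℝ → ℝ}
    (hg : ∀ x, 1 ≤ x → 0 < g x) {c : ℝ} (hc : 0 < c) {m₁ m₂ : (Fin d → ℤ) → ℝ}
    (hm₁e : ∀ k, m₁ (-k) = m₁ k) (hm₂e : ∀ k, m₂ (-k) = m₂ k)
    (hm₁ : ∀ k, k ≠ 0 → c * (freqNorm k ^ α / g (freqNorm k)) ≤ m₁ k)
    (hm₂ : ∀ k, k ≠ 0 → c * freqNorm k ^ β ≤ m₂ k) : IsSymbolPair c m₁ m₂ where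
  pos := hc
  nonneg k hk := by
    refine le_trans ?_ (hm₁ k hk)
    have := hg _ (one_le_freqNorm hk)
    have := freqNorm_nonneg k
    positivity
  even₁ := hm₁e
  le k hk := (le_mul_of_one_le_right hc.le (Real.one_le_rpow (one_le_freqNorm hk) hβ)).trans
    (hm₂ k hk)
  even₂ := hm₂e

/-- A maximal solution in `H^γ` whose norm is bounded is global. -/
theorem IsMaximalSolution.eq_top_of_bounded {c : ℝ} {m₁ m₂ : (Fin d → ℤ) → ℝ}
    (hs : IsSymbolPair c m₁ m₂) {γ : ℝ} (hγ : 2 + (d : ℝ) / 2 ≤ γ) {T : ℝ≥0∞} {v : ℝ → Field d}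
    (hv : IsMaximalSolution γ m₁ m₂ T v) {M : ℝ}
    (hM : ∀ t ∈ timeInterval T, sobNormSq γ (v t) ≤ M) : T = ⊤ := by
  by_contra hT
  -- If `T` were zero, `timeInterval T` would be empty and `hM` void; including the initial norm
  -- lets local existence show `T > 0`.
  set Q := max M (sobNormSq γ (v 0))
  have hQ0 : 0 ≤ Q := (tsum_nonneg (sobTerm_nonneg γ (v 0))).trans (le_max_right _ _)
  have hA := energyConst_nonneg d ⌈2 * γ⌉₊ γ hs.pos
  set A := energyConst d ⌈2 * γ⌉₊ γ c
  obtain ⟨τ, hτ0, hτ⟩ : ∃ τ : ℝ, 0 < τ ∧ A * τ ≤ (√(Q + 1))⁻¹ := by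
    refine ⟨(√(Q + 1))⁻¹ / (A + 1), by positivity, ?_⟩
    rw [mul_div_assoc', div_le_iff₀ (by positivity), mul_comm]
    exact mul_le_mul_of_nonneg_left (by linarith) (by positivity)
  have hmax : ∀ r : ℝ, 0 < r → (∃ w : ℝ → Field d, w 0 = v 0 ∧
      IsSolutionOn γ m₁ m₂ (Icc 0 r) w) → r ≤ T.toReal := by
    intro r hr hw
    rw [← ENNReal.ofReal_le_iff_le_toReal hT, hv.maximal]
    exact le_sSup ⟨r, hr, rfl, hw⟩
  have hT0 : 0 < T.toReal := hτ0.trans_le (hmax τ hτ0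
    (exists_isSolutionOn hs hγ hv.initial (le_max_right _ _) hτ0.le hτ))
  -- A restart at a time `a < T` with `a ≥ T - τ/2` gives a solution up to `a + τ > T`.
  set a := max 0 (T.toReal - τ / 2)
  have ha0 : 0 ≤ a := le_max_left _ _
  have haT : a < T.toReal := max_lt hT0 (by linarith)
  have hmem : Icc 0 a ⊆ timeInterval T := fun t ht =>
    ⟨ht.1, (ENNReal.ofReal_lt_iff_lt_toReal ht.1 hT).2 (ht.2.trans_lt haT)⟩
  have ha := hmem (right_mem_Icc.2 ha0)
  obtain ⟨w, hw0, hw⟩ := exists_isSolutionOn hs hγ (hv.solution.memV a ha)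
    ((hM a ha).trans (le_max_left _ _)) hτ0.le hτ
  have h1 := hmax (a + τ) (by linarith)
    ((hv.solution.mono hmem).exists_extension ha0 hτ0.le hw hw0)
  have h2 : T.toReal - τ / 2 ≤ a := le_max_right _ _
  linarith

end LerayAlpha

/-! ### The continuation criterion in terms of the shell approximation -/

theorem mainTheorem5 (d : ℕ) (hd : 2 ≤ d) (α β : ℝ) (hα : 0 ≤ α) (hβ : 0 ≤ β)
    (hαβ : ((d : ℝ) + 2) / 2 ≤ α + β)
    (g : ℝ → ℝ) (hg_nonneg : ∀ x, 0 ≤ x → 0 ≤ g x) (hg_mono : MonotoneOn g (Set.Ici 0))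
    (hg_pos : ∀ x, 1 ≤ x → 0 < g x)
    (hg_anti : ∃ R : ℝ, 0 < R ∧ AntitoneOn (fun x : ℝ => x ^ (-α) * g x) (Set.Ici R))
    (hg_int : ∫⁻ s in Set.Ioi (1 : ℝ), ENNReal.ofReal (1 / (s * g s)) = ⊤)
    (c : ℝ) (hc : 0 < c) (m₁ m₂ : (Fin d → ℤ) → ℝ)
    (hm₁_even : ∀ k, m₁ (-k) = m₁ k) (hm₂_even : ∀ k, m₂ (-k) = m₂ k)
    (hm₁ : ∀ k, k ≠ 0 → c * (LerayAlpha.freqNorm k ^ α / g (LerayAlpha.freqNorm k)) ≤ m₁ k)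
    (hm₂ : ∀ k, k ≠ 0 → c * LerayAlpha.freqNorm k ^ β ≤ m₂ k)
    (m : ℝ) (hm : 2 + (d : ℝ) / 2 ≤ m)
    (Φ : ℝ → ℝ) (hΦ : LerayAlpha.IsCutoff Φ)
    (Tstar : ℝ≥0∞) (v : ℝ → LerayAlpha.Field d)
    (hv_smooth : LerayAlpha.IsSmoothPeriodic (v 0))
    (hv : LerayAlpha.IsMaximalSolution m m₁ m₂ Tstar v)
    (hX : (⨆ t ∈ LerayAlpha.timeInterval Tstar,
      ∑' n : ℕ, ENNReal.ofReal
        ((2 : ℝ) ^ (2 * m * (n : ℝ)) * LerayAlpha.shellApprox Φ v n t ^ 2)) < ⊤) :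
    Tstar = ⊤ := by
  have hm0 : 0 ≤ m := by
    have : (0 : ℝ) ≤ d := Nat.cast_nonneg d
    linarith
  refine hv.eq_top_of_bounded
    (LerayAlpha.isSymbolPair_of_le hβ hg_pos hc hm₁_even hm₂_even hm₁ hm₂) hm fun t ht =>
    hΦ.sobNormSq_le hm0 (hv.solution.memV t ht) hX.ne ?_
  exact le_iSup₂ (f := fun t (_ : t ∈ LerayAlpha.timeInterval Tstar) =>
    ∑' n : ℕ, ENNReal.ofReal
      ((2 : ℝ) ^ (2 * m * (n : ℝ)) * LerayAlpha.shellApprox Φ v n t ^ 2)) t ht
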